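/- Let $(G_n)_{n\ge 1}$ be probability distributions on $\mathbb R$ and let $\Phi=N(0,1)$. For $\beta\ge 0$ put $\pi_n=n^{-\beta}$. Under $H_0^n$ the coordinates of $X\in\mathbb R^n$ are i.i.d. $\Phi$. Under $H_1^n=H_1^n(\beta)$ they are $X_i=\mu_i+Z_i$ with $\mu_1,\dots,\mu_n$ i.i.d. from $(1-\pi_n)\delta_0+\pi_nG_n$ and, independently, $Z_1,\dots,Z_n$ i.i.d. from $\Phi$. Let $d_{TV}(P,Q)=\sup_A|P(A)-Q(A)|$ and put $$\underline\beta^*=\sup\{\beta\ge 0:\ d_{TV}(H_0^n,H_1^n(\beta))\to 1\},\qquad \bar\beta^*=\inf\{\beta\in[0,1]:\ d_{TV}(H_0^n,H_1^n(\beta))\to 0\}\qquad(n\to\infty),$$ with $\sup\emptyset=0$ and $\inf\emptyset=1$. If $\underline\beta^*=\bar\beta^*$, the common value $\beta^*$ is called the critical sparsity level. Let $$\tau_n(\delta)=\log_n \mathbb P\big(|\mu+Z|>\sqrt{2\delta\log n}\big),\qquad \mu\sim G_n,\ Z\sim\Phi\ \text{independent},$$ and assume that $\tau_n$ converges uniformly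 on $[0,1]$ as $n\to\infty$ to some real-valued function. For $\alpha\in(0,1)$, the level-$\alpha$ max test rejects when $\max_i|X_i|>m(n,\alpha)$, where $m(n,\alpha)$ is the $(1-\alpha)$-quantile of $\max_i|X_i|$ under $H_0^n$. **Theorem 1.** Suppose that $\bar\beta^*>1/2$ (as is the case when $\beta^*$ exists and exceeds $1/2$), and that either (A1) $\bar\beta^*>3/4$, or (A2) there are a distribution function $G$ on $\mathbb R$ and numbers $\sigma_n>0$ such that $G_n(\mu)=G(\mu/\sigma_n)$ for all $n$ and $\mu$ (here $G_n$ denotes the distribution function), and $Q(\theta)=-\max\{\log(1-G(\theta)),\log G(-\theta)\}$ (with $\log 0=-\infty$) is finite and positive for all large $\theta$ and is regularly varying with some index $\gamma\le 2$, i.e. $Q(t\theta)/Q(\theta)\to t^{\gamma}$ as $\theta\to\infty$ for every $t>0$. Then the critical sparsity level exists, i.e. $\underline\beta^*=\bar\beta^*=\beta^*$, and for every $\beta\in(0,\beta^*)$ and every $\alpha\in(0,1)$ the level-$\alpha$ max test has full asymptotic power: $\mathbb P_{H_1^n(\beta)}\big(\max_i|X_i|>m(n,\alpha)\big)\to 1$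 as $n\to\infty$. -/

import Mathlib

open MeasureTheory ProbabilityTheory Filter Topology

noncomputable section

namespace SparseMeans

/-- Law of a single mean under the alternative: `(1 - n^{-β}) δ₀ + n^{-β} G`. -/
def prior (G : Measure ℝ) (n : ℕ) (β : ℝ) : Measure ℝ :=
  ENNReal.ofReal (1 - (n : ℝ) ^ (-β)) • Measure.dirac 0 + ENNReal.ofReal ((n : ℝ) ^ (-β)) • G

/-- Law of `μ + Z` with `μ ∼ ν` and an independent standard normal `Z`. -/
def gaussianMixture (ν : Measure ℝ) : Measure ℝ :=
  Measure.conv ν (gaussianReal 0 1)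

/-- Law of the observation vector `X ∈ ℝⁿ` under the global null: `n` i.i.d. standard normals. -/
def nullLaw (n : ℕ) : Measure (Fin n → ℝ) :=
  Measure.pi fun _ => gaussianReal 0 1

/-- Law of `X ∈ ℝⁿ` under the alternative: `Xᵢ = μᵢ + Zᵢ`, with i.i.d. means `μᵢ` drawn from the
sparse mixture and independent i.i.d. standard normal `Zᵢ`. -/
def altLaw (G : ℕ → Measure ℝ) (β : ℝ) (n : ℕ) : Measure (Fin n → ℝ) :=
  Measure.pi fun _ => gaussianMixture (prior (G n) n β)

/-- Total variation distance `sup_A |P(A) - Q(A)|` over measurable sets. -/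
def tvDist {Ω : Type*} [MeasurableSpace Ω] (P Q : Measure Ω) : ℝ :=
  sSup {r : ℝ | ∃ A : Set Ω, MeasurableSet A ∧ r = |P.real A - Q.real A|}

/-- The lower critical sparsity level `sup {β ≥ 0 : d_TV → 1}` (it is `0` if there is no such
`β`). -/
def lowerCriticalSparsity (G : ℕ → Measure ℝ) : ℝ :=
  sSup (insert 0 {β : ℝ | 0 ≤ β ∧
    Tendsto (fun n => tvDist (nullLaw n) (altLaw G β n)) atTop (𝓝 1)})

/-- The upper critical sparsity level `inf {0 ≤ β ≤ 1 : d_TV → 0}` (it is `1` if there is no such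
`β`). -/
def upperCriticalSparsity (G : ℕ → Measure ℝ) : ℝ :=
  sInf (insert 1 {β : ℝ | 0 ≤ β ∧ β ≤ 1 ∧
    Tendsto (fun n => tvDist (nullLaw n) (altLaw G β n)) atTop (𝓝 0)})

/-- `b` is the critical sparsity level: both one-sided levels are equal to `b`. -/
def IsCriticalSparsityLevel (G : ℕ → Measure ℝ) (b : ℝ) : Prop :=
  lowerCriticalSparsity G = b ∧ upperCriticalSparsity G = b

/-- `τ_n(δ) = log_n P(|X| > √(2 δ log n))` for one observation `X = μ + Z` with `μ ∼ G n`. -/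
def tau (G : ℕ → Measure ℝ) (n : ℕ) (δ : ℝ) : ℝ :=
  Real.logb n ((gaussianMixture (G n)).real {x : ℝ | √(2 * δ * Real.log n) < |x|})

/-- The statistic of the max test, `maxᵢ |xᵢ|`. -/
def maxStat {n : ℕ} (x : Fin n → ℝ) : ℝ :=
  ⨆ i, |x i|

/-- Critical value of the level-`α` max test: the `1 - α` quantile of `maxᵢ |Xᵢ|` under the
null. -/
def maxCritVal (n : ℕ) (α : ℝ) : ℝ :=
  sInf {t : ℝ | 1 - α ≤ (nullLaw n).real {x | maxStat x ≤ t}}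

/-- Power of the level-`α` max test, which rejects when `maxᵢ |Xᵢ|` exceeds its critical value. -/
def maxTestPower (G : ℕ → Measure ℝ) (β α : ℝ) (n : ℕ) : ℝ :=
  (altLaw G β n).real {x | maxCritVal n α < maxStat x}

/-- `Q` is (eventually positive and) regularly varying at `+∞` with index `γ`. -/
def RegularlyVarying (Q : ℝ → ℝ) (γ : ℝ) : Prop :=
  (∀ᶠ x in atTop, 0 < Q x) ∧
    ∀ t : ℝ, 0 < t → Tendsto (fun x => Q (t * x) / Q x) atTop (𝓝 (t ^ γ))

/-- `-max {log (1 - G(θ)), log G(-θ)}` for the distribution function of `G`. The maximum is taken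
inside the logarithm, so that a tail of mass zero counts as `log 0 = -∞`. -/
def tailExponent (G : Measure ℝ) (θ : ℝ) : ℝ :=
  -Real.log (max (1 - cdf G θ) (cdf G (-θ)))

end SparseMeans

end

/-!
Everything reduces to `1 + τ(1)`, where `τ` is the limit of `τ_n`. The contamination is rare, so the
total variation distance between single observations, and hence between the samples, is controlled
by the second moment of the likelihood ratio truncated to `|x| ≤ √(2 log n)`, together with the mass
that the alternative puts beyond the truncation. Up to arbitrarily small powers of `n`, these add up
over the sample to at most `n ^ (1 - 2 β + 2 sup (τ(δ) + δ / 2))`, the supremum being over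
`δ ∈ [0, 1]`, and `n ^ (1 - β + τ(1))`, so nothing can be detected once `β` exceeds
`1 / 2 + sup (τ(δ) + δ / 2)`. On the other hand the max test detects as soon as `β < 1 + τ(1)`,
which is what `δ = 1` gives in that supremum. It remains to see that no `δ` beats `δ = 1`.

Cutting `[0, ∞)` into finitely many shells shows that `P(|μ + Z| > d √(2 log n))` has the order of
`n ^ (-d² (1 - u)²) P(|μ| > u d √(2 log n))` for some `u ∈ [0, 1]`, which is then compared with the
contribution of `|μ| > v √(2 log n)` to the tail at `δ = 1`. Under (A1) one takes `v = u d`: an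
exponent above `1 / 4` forces `u d > 1 / 2`, and in this range raising the threshold from
`d √(2 log n)` to `√(2 log n)` costs at most the factor `n ^ ((1 - d²) / 2)` which the term `δ / 2`
gains. Under (A2) one takes `v = u`: regular variation with index `γ ≤ 2` gives `τ(d²) ≤ d² τ(1)`,
unless `σ_n` is at least of order `√(2 log n)` along a subsequence, in which case `τ(1) = 0`.
-/

noncomputable section

namespace SparseMeans

section GaussianTail

/-- The upper tail `P(Z > t)` of a standard Gaussian variable `Z`. -/
def gaussianTail (t : ℝ) : ℝ :=
  (gaussianReal 0 1).real (Set.Ioi t)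

/-- The constant lost when a Gaussian density is compared with the tail beyond the same point. -/
def gaussianTailConst : ℝ :=
  Real.exp (3 / 2) * √(2 * Real.pi)

/-- The two-sided tail `P(|X| > t)` of the law `P` of a real random variable `X`. -/
def absTail (P : Measure ℝ) (t : ℝ) : ℝ :=
  P.real {x | t < |x|}

lemma gaussianTailConst_pos : 0 < gaussianTailConst := by
  unfold gaussianTailConst; positivity

lemma gaussianTail_nonneg (t : ℝ) : 0 ≤ gaussianTail t :=
  measureReal_nonneg

lemma antitone_gaussianTail : Antitone gaussianTail := fun _ _ h =>
  measureReal_mono (Set.Ioi_subset_Ioi h)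

lemma gaussianReal_zero_one_real_eq_integral (s : Set ℝ) :
    (gaussianReal 0 1).real s = ∫ y in s, gaussianPDFReal 0 1 y := by
  rw [Measure.real, gaussianReal_apply_eq_integral _ one_ne_zero, ENNReal.toReal_ofReal]
  exact integral_nonneg fun y => gaussianPDFReal_nonneg 0 1 y

lemma gaussianPDFReal_zero_one (y : ℝ) :
    gaussianPDFReal 0 1 y = (√(2 * Real.pi))⁻¹ * Real.exp (-y ^ 2 / 2) := by
  simp [gaussianPDFReal]

-- The interval `(t, t + 1 / (1 + x)]` carries enough mass: there `y ^ 2 ≤ t ^ 2 + 3`.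
lemma exp_neg_sq_div_two_le_mul_gaussianTail {t x : ℝ} (hx : 0 ≤ x) (htx : t ≤ x) :
    Real.exp (-t ^ 2 / 2) ≤ gaussianTailConst * (1 + x) * gaussianTail t := by
  set w := (1 + x)⁻¹ with hw
  have hw0 : 0 < w := by positivity
  have hw1 : w ≤ 1 := inv_le_one_of_one_le₀ (by linarith)
  have hxw : x * w ≤ 1 := by
    rw [hw, ← div_eq_mul_inv, div_le_one (by positivity)]; linarith
  have hdensity : ∀ y ∈ Set.Ioc t (t + w),
      Real.exp (-t ^ 2 / 2) / gaussianTailConst ≤ gaussianPDFReal 0 1 y := by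
    rintro y ⟨hy, hyw⟩
    have h1 : t * (y - t) ≤ 1 := by nlinarith
    have h2 : (y - t) ^ 2 ≤ 1 := by nlinarith
    rw [gaussianPDFReal_zero_one, gaussianTailConst, div_mul_eq_div_div, ← Real.exp_sub,
      div_eq_inv_mul]
    gcongr
    nlinarith
  have hmass : w * (Real.exp (-t ^ 2 / 2) / gaussianTailConst) ≤ gaussianTail t := by
    calc w * (Real.exp (-t ^ 2 / 2) / gaussianTailConst)
        = ∫ _y in Set.Ioc t (t + w), Real.exp (-t ^ 2 / 2) / gaussianTailConst := by
          simp [hw0.le]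
      _ ≤ ∫ y in Set.Ioc t (t + w), gaussianPDFReal 0 1 y :=
          setIntegral_mono_on (integrable_const _) (integrable_gaussianPDFReal 0 1).integrableOn
            measurableSet_Ioc hdensity
      _ = (gaussianReal 0 1).real (Set.Ioc t (t + w)) :=
          (gaussianReal_zero_one_real_eq_integral _).symm
      _ ≤ gaussianTail t := measureReal_mono Set.Ioc_subset_Ioi_self
  have hC := gaussianTailConst_pos
  calc Real.exp (-t ^ 2 / 2)
      = gaussianTailConst * (1 + x) * (w * (Real.exp (-t ^ 2 / 2) / gaussianTailConst)) := by
        rw [hw]; field_simp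
    _ ≤ gaussianTailConst * (1 + x) * gaussianTail t := by gcongr

lemma gaussianTail_pos (t : ℝ) : 0 < gaussianTail t :=
  pos_of_mul_pos_right
    ((Real.exp_pos _).trans_le
      (exp_neg_sq_div_two_le_mul_gaussianTail (abs_nonneg t) (le_abs_self t)))
    (by have := gaussianTailConst_pos; positivity)

lemma gaussianTail_le_exp {t : ℝ} (ht : 0 ≤ t) : gaussianTail t ≤ Real.exp (-t ^ 2 / 2) := by
  have h := measure_ge_le_exp_mul_mgf (μ := gaussianReal 0 1) (X := id) t ht
    (integrable_exp_mul_gaussianReal t)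
  rw [mgf_id_gaussianReal, ← Real.exp_add] at h
  refine (measureReal_mono fun y (hy : t < y) => hy.le).trans (h.trans_eq ?_)
  congr 1; push_cast; ring

lemma gaussianTail_le_exp_neg_max_sq (s : ℝ) :
    gaussianTail s ≤ Real.exp (-max s 0 ^ 2 / 2) := by
  rcases le_total 0 s with hs | hs
  · simpa only [max_eq_left hs] using gaussianTail_le_exp hs
  · simp only [max_eq_right hs, ne_eq, OfNat.ofNat_ne_zero, not_false_eq_true, zero_pow, neg_zero,
      zero_div, Real.exp_zero]
    exact measureReal_le_one

lemma gaussianTail_le_exp_div {t : ℝ} (ht : 0 < t) :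
    gaussianTail t ≤ Real.exp (-t ^ 2 / 2) / t := by
  have hint : IntegrableOn (fun y => Real.exp (-t * y)) (Set.Ioi t) :=
    integrableOn_exp_mul_Ioi (by linarith) t
  have hdensity : ∀ y, gaussianPDFReal 0 1 y ≤ Real.exp (t ^ 2 / 2) * Real.exp (-t * y) := by
    intro y
    rw [gaussianPDFReal_zero_one, ← Real.exp_add]
    refine (mul_le_of_le_one_left (Real.exp_pos _).le (inv_le_one_of_one_le₀ ?_)).trans ?_
    · rw [Real.one_le_sqrt]; nlinarith [Real.pi_gt_three]
    · gcongr; nlinarith [sq_nonneg (y - t)]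
  calc gaussianTail t = ∫ y in Set.Ioi t, gaussianPDFReal 0 1 y :=
        gaussianReal_zero_one_real_eq_integral _
    _ ≤ ∫ y in Set.Ioi t, Real.exp (t ^ 2 / 2) * Real.exp (-t * y) :=
        setIntegral_mono_on (integrable_gaussianPDFReal 0 1).integrableOn
          (hint.const_mul _) measurableSet_Ioi fun y _ => hdensity y
    _ = Real.exp (-t ^ 2 / 2) / t := by
        rw [integral_const_mul, integral_exp_mul_Ioi (by linarith), neg_div_neg_eq, mul_div_assoc',
          ← Real.exp_add]
        congr 2; ring

lemma gaussianReal_apply_eq_preimage_add (m : ℝ) {s : Set ℝ} (hs : MeasurableSet s) :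
    gaussianReal m 1 s = gaussianReal 0 1 ((m + ·) ⁻¹' s) := by
  have h := gaussianReal_map_const_add (μ := 0) (v := 1) m
  rw [zero_add] at h
  rw [← h, Measure.map_apply (by fun_prop) hs]

lemma gaussianReal_real_Ioi (m t : ℝ) :
    (gaussianReal m 1).real (Set.Ioi t) = gaussianTail (t - m) := by
  rw [Measure.real, gaussianReal_apply_eq_preimage_add m measurableSet_Ioi,
    Set.preimage_const_add_Ioi]
  rfl

lemma gaussianReal_real_Iio_neg (m t : ℝ) :
    (gaussianReal m 1).real (Set.Iio (-t)) = gaussianTail (t + m) := by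
  have h := gaussianReal_map_neg (μ := -m) (v := 1)
  rw [neg_neg] at h
  rw [← h, map_measureReal_apply (by fun_prop) measurableSet_Iio, ← sub_neg_eq_add,
    ← gaussianReal_real_Ioi]
  congr 1; ext y; simp

lemma setOf_lt_abs_eq_union (t : ℝ) : {x : ℝ | t < |x|} = Set.Ioi t ∪ Set.Iio (-t) := by
  ext x; simp [lt_abs, lt_neg]

lemma measurableSet_lt_abs (t : ℝ) : MeasurableSet {x : ℝ | t < |x|} :=
  measurableSet_lt measurable_const (by fun_prop)

lemma absTail_nonneg (P : Measure ℝ) (t : ℝ) : 0 ≤ absTail P t :=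
  measureReal_nonneg

lemma absTail_le_one (P : Measure ℝ) [IsProbabilityMeasure P] (t : ℝ) : absTail P t ≤ 1 :=
  measureReal_le_one

lemma antitone_absTail (P : Measure ℝ) [IsFiniteMeasure P] : Antitone (absTail P) :=
  fun _ _ h => measureReal_mono fun _ hx => h.trans_lt hx

lemma absTail_gaussianReal_le (m t : ℝ) :
    absTail (gaussianReal m 1) t ≤ 2 * gaussianTail (t - |m|) := by
  have hright : gaussianTail (t - m) ≤ gaussianTail (t - |m|) :=
    antitone_gaussianTail (by linarith [le_abs_self m])
  have hleft : gaussianTail (t + m) ≤ gaussianTail (t - |m|) :=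
    antitone_gaussianTail (by linarith [neg_abs_le m])
  rw [absTail, setOf_lt_abs_eq_union]
  refine (measureReal_union_le _ _).trans ?_
  rw [gaussianReal_real_Ioi, gaussianReal_real_Iio_neg]
  linarith

lemma gaussianTail_le_absTail_gaussianReal (m t : ℝ) :
    gaussianTail (t - |m|) ≤ absTail (gaussianReal m 1) t := by
  rw [absTail, setOf_lt_abs_eq_union]
  rcases abs_choice m with hm | hm
  · rw [hm, ← gaussianReal_real_Ioi]
    exact measureReal_mono Set.subset_union_left
  · rw [hm, sub_neg_eq_add, ← gaussianReal_real_Iio_neg]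
    exact measureReal_mono Set.subset_union_right

end GaussianTail

section GaussianMixture

instance isProbabilityMeasure_gaussianMixture (ν : Measure ℝ) [IsProbabilityMeasure ν] :
    IsProbabilityMeasure (gaussianMixture ν) := by
  unfold gaussianMixture; infer_instance

lemma measurable_gaussianReal_apply {s : Set ℝ} (hs : MeasurableSet s) :
    Measurable fun m : ℝ => gaussianReal m 1 s := by
  simp_rw [fun m => gaussianReal_apply_eq_preimage_add m hs]
  exact measurable_measure_prodMk_left (measurable_add hs)

lemma gaussianMixture_apply (ν : Measure ℝ) [SFinite ν] {s : Set ℝ} (hs : MeasurableSet s) :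
    gaussianMixture ν s = ∫⁻ m, gaussianReal m 1 s ∂ν := by
  rw [gaussianMixture, Measure.conv, Measure.map_apply (by fun_prop) hs,
    Measure.prod_apply (measurable_add hs)]
  exact lintegral_congr fun m => (gaussianReal_apply_eq_preimage_add m hs).symm

variable (ν : Measure ℝ)

lemma integrable_absTail_gaussianReal [IsFiniteMeasure ν] (t : ℝ) :
    Integrable (fun m => absTail (gaussianReal m 1) t) ν :=
  Integrable.of_bound
    (measurable_gaussianReal_apply (measurableSet_lt_abs t)).ennreal_toReal.aestronglyMeasurable 1
    (ae_of_all _ fun m => by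
      rw [Real.norm_of_nonneg (absTail_nonneg _ _)]
      exact absTail_le_one _ _)

lemma absTail_gaussianMixture [SFinite ν] (t : ℝ) :
    absTail (gaussianMixture ν) t = ∫ m, absTail (gaussianReal m 1) t ∂ν := by
  have hs := measurableSet_lt_abs t
  rw [absTail, Measure.real, gaussianMixture_apply ν hs, ← integral_toReal
    (measurable_gaussianReal_apply hs).aemeasurable (ae_of_all _ fun m => measure_lt_top _ _)]
  rfl

lemma absTail_gaussianMixture_pos [IsProbabilityMeasure ν] (t : ℝ) :
    0 < absTail (gaussianMixture ν) t := by
  rw [absTail_gaussianMixture, integral_pos_iff_support_of_nonneg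
    (fun m => absTail_nonneg _ _) (integrable_absTail_gaussianReal ν t)]
  have hsupp : Function.support (fun m => absTail (gaussianReal m 1) t) = Set.univ :=
    Set.eq_univ_of_forall fun m =>
      ((gaussianTail_pos _).trans_le (gaussianTail_le_absTail_gaussianReal m t)).ne'
  simp [hsupp]

lemma gaussianMixture_smul_dirac_add_smul [SFinite ν] (a b : ENNReal) :
    gaussianMixture (a • Measure.dirac 0 + b • ν) =
      a • gaussianReal 0 1 + b • gaussianMixture ν := by
  simp only [gaussianMixture]
  rw [Measure.add_conv, Measure.conv_smul_left, Measure.conv_smul_left, Measure.dirac_zero_conv]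

end GaussianMixture

section TotalVariation

variable {Ω : Type*} [MeasurableSpace Ω] (P Q : Measure Ω) [IsProbabilityMeasure P]
  [IsProbabilityMeasure Q]

lemma tvDist_le_of_real_sub_le {r : ℝ} (h : ∀ A, MeasurableSet A → P.real A - Q.real A ≤ r) :
    tvDist P Q ≤ r := by
  refine csSup_le ⟨_, ∅, MeasurableSet.empty, rfl⟩ ?_
  rintro _ ⟨A, hA, rfl⟩
  have hcompl := h Aᶜ hA.compl
  rw [probReal_compl_eq_one_sub hA, probReal_compl_eq_one_sub hA] at hcompl
  exact abs_sub_le_iff.2 ⟨h A hA, by linarith⟩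

lemma tvDist_le_one : tvDist P Q ≤ 1 :=
  tvDist_le_of_real_sub_le P Q fun _ _ =>
    (sub_le_self _ measureReal_nonneg).trans measureReal_le_one

lemma real_sub_real_le_tvDist {A : Set Ω} (hA : MeasurableSet A) :
    P.real A - Q.real A ≤ tvDist P Q := by
  refine (le_abs_self _).trans (le_csSup ⟨1, ?_⟩ ⟨A, hA, rfl⟩)
  rintro _ ⟨B, _, rfl⟩
  exact abs_sub_le_of_nonneg_of_le measureReal_nonneg measureReal_le_one measureReal_nonneg
    measureReal_le_one

lemma tvDist_nonneg : 0 ≤ tvDist P Q := by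
  simpa using real_sub_real_le_tvDist P Q MeasurableSet.empty

end TotalVariation

section SecondMoment

variable {Ω : Type*} [MeasurableSpace Ω] {P Q : Measure Ω} [IsProbabilityMeasure P] {g : Ω → ℝ}

lemma integral_abs_le_sqrt_integral_sq (hg : MemLp g 2 P) :
    ∫ x, |g x| ∂P ≤ √(∫ x, g x ^ 2 ∂P) := by
  have hvar := variance_nonneg |g| P
  rw [variance_eq_sub hg.abs] at hvar
  exact Real.le_sqrt_of_sq_le (by simpa using hvar)

lemma integral_one_sub_sq (hg : MemLp g 2 P) :
    ∫ x, (1 - g x) ^ 2 ∂P = 1 - 2 * ∫ x, g x ∂P + ∫ x, g x ^ 2 ∂P := by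
  have hint : Integrable (fun x => 2 * g x) P := (hg.integrable one_le_two).const_mul 2
  have hexpand : ∀ x, (1 - g x) ^ 2 = 1 - 2 * g x + g x ^ 2 := fun x => by ring
  simp_rw [hexpand]
  rw [integral_add (f := fun x => 1 - 2 * g x) ((integrable_const _).sub hint) hg.integrable_sq,
    integral_sub (integrable_const _) hint, integral_const_mul]
  simp

lemma real_sub_real_le_sqrt [IsFiniteMeasure Q] (hg0 : ∀ x, 0 ≤ g x) (hg : MemLp g 2 P)
    (hgQ : P.withDensity (fun x => ENNReal.ofReal (g x)) ≤ Q) {E : Set Ω} (hE : MeasurableSet E) :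
    P.real E - Q.real E ≤ √(1 - 2 * ∫ x, g x ∂P + ∫ x, g x ^ 2 ∂P) := by
  have hint : Integrable g P := hg.integrable one_le_two
  have hint' : Integrable (fun x => 1 - g x) P := (integrable_const 1).sub hint
  have hQ : ∫ x in E, g x ∂P ≤ Q.real E := by
    refine (ENNReal.ofReal_le_iff_le_toReal (measure_ne_top Q E)).1 ?_
    rw [ofReal_integral_eq_lintegral_ofReal hint.integrableOn (ae_of_all _ hg0),
      ← withDensity_apply _ hE]
    exact hgQ E
  calc P.real E - Q.real E ≤ P.real E - ∫ x in E, g x ∂P := by gcongr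
    _ = ∫ x in E, (1 - g x) ∂P := by
        rw [integral_sub (integrable_const _) hint.integrableOn]; simp
    _ ≤ ∫ x in E, |1 - g x| ∂P :=
        integral_mono hint'.integrableOn hint'.abs.integrableOn fun x => le_abs_self _
    _ ≤ ∫ x, |1 - g x| ∂P :=
        setIntegral_le_integral hint'.abs (ae_of_all _ fun x => abs_nonneg _)
    _ ≤ √(∫ x, (1 - g x) ^ 2 ∂P) :=
        integral_abs_le_sqrt_integral_sq ((memLp_const 1).sub hg)
    _ = _ := by rw [integral_one_sub_sq hg]

end SecondMoment

section ProductMeasure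

variable {ι : Type*} [Fintype ι]

lemma pi_mono {α : ι → Type*} [∀ i, MeasurableSpace (α i)] {μ ν : ∀ i, Measure (α i)}
    [∀ i, SigmaFinite (μ i)] (h : ∀ i, μ i ≤ ν i) : Measure.pi μ ≤ Measure.pi ν := by
  have houter : (Measure.pi μ).toOuterMeasure ≤
      OuterMeasure.pi fun i => (ν i).toOuterMeasure := by
    refine OuterMeasure.le_pi.2 fun s _ => ?_
    exact (Measure.pi_pi μ s).trans_le (Finset.prod_le_prod' fun i _ => h i (s i))
  refine Measure.le_iff'.2 fun s => (houter s).trans ?_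
  rw [Measure.pi]
  exact le_toMeasure_apply _ _ s

variable {Ω : Type*} [MeasurableSpace Ω] {P : Measure Ω} {g : Ω → ℝ}

lemma pi_withDensity_ofReal [SigmaFinite P] (hg0 : ∀ x, 0 ≤ g x) (hg : Integrable g P) :
    Measure.pi (fun _ : ι => P.withDensity fun x => ENNReal.ofReal (g x)) =
      (Measure.pi fun _ : ι => P).withDensity fun x => ENNReal.ofReal (∏ i, g (x i)) := by
  have := isFiniteMeasure_withDensity_ofReal hg.2
  refine Measure.pi_eq fun s hs => ?_
  have hfactor (i : ι) : (P.withDensity fun x => ENNReal.ofReal (g x)) (s i) =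
      ENNReal.ofReal (∫ x in s i, g x ∂P) := by
    rw [withDensity_apply _ (hs i), ofReal_integral_eq_lintegral_ofReal hg.integrableOn
      (ae_of_all _ hg0)]
  rw [withDensity_apply _ (MeasurableSet.univ_pi hs), Measure.restrict_pi_pi,
    ← ofReal_integral_eq_lintegral_ofReal (Integrable.fintype_prod fun i => hg.integrableOn)
      (ae_of_all _ fun x => Finset.prod_nonneg fun i _ => hg0 _),
    integral_fintype_prod_eq_prod (fun _ => g),
    ENNReal.ofReal_prod_of_nonneg fun i _ => integral_nonneg hg0]
  exact Finset.prod_congr rfl fun i _ => (hfactor i).symm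

lemma memLp_two_prod_pi [SigmaFinite P] (hg : MemLp g 2 P) :
    MemLp (fun x : ι → Ω => ∏ i, g (x i)) 2 (Measure.pi fun _ => P) := by
  have hmeas : AEStronglyMeasurable (fun x : ι → Ω => ∏ i, g (x i)) (Measure.pi fun _ => P) :=
    Finset.aestronglyMeasurable_fun_prod _ fun i _ =>
      hg.1.comp_quasiMeasurePreserving (Measure.quasiMeasurePreserving_eval _ i)
  rw [memLp_two_iff_integrable_sq hmeas]
  simp_rw [← Finset.prod_pow]
  exact Integrable.fintype_prod fun _ => hg.integrable_sq

lemma tvDist_pi_le_sqrt [IsProbabilityMeasure P] {Q : Measure Ω} [IsProbabilityMeasure Q]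
    (hg0 : ∀ x, 0 ≤ g x) (hg : MemLp g 2 P)
    (hgQ : P.withDensity (fun x => ENNReal.ofReal (g x)) ≤ Q) :
    tvDist (Measure.pi fun _ : ι => P) (Measure.pi fun _ : ι => Q) ≤
      √(1 - 2 * (∫ x, g x ∂P) ^ Fintype.card ι + (∫ x, g x ^ 2 ∂P) ^ Fintype.card ι) := by
  have hint : Integrable g P := hg.integrable one_le_two
  have := isFiniteMeasure_withDensity_ofReal hint.2
  have hprod0 (x : ι → Ω) : 0 ≤ ∏ i, g (x i) := Finset.prod_nonneg fun i _ => hg0 _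
  have hdom : ((Measure.pi fun _ : ι => P).withDensity fun x => ENNReal.ofReal (∏ i, g (x i))) ≤
      Measure.pi fun _ : ι => Q := by
    rw [← pi_withDensity_ofReal hg0 hint]
    exact pi_mono fun _ => hgQ
  refine tvDist_le_of_real_sub_le _ _ fun E hE => ?_
  refine (real_sub_real_le_sqrt hprod0 (memLp_two_prod_pi hg) hdom hE).trans_eq ?_
  simp_rw [← Finset.prod_pow]
  rw [integral_fintype_prod_eq_pow g, integral_fintype_prod_eq_pow fun x => g x ^ 2]

end ProductMeasure

section Contamination

variable {Ω : Type*} [MeasurableSpace Ω] {P : Measure Ω} {p : ℝ}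

lemma withDensity_ofReal_add_mul_le {h k : Ω → ℝ} (hk : ∀ x, k x ≤ h x) (hp0 : 0 ≤ p) :
    P.withDensity (fun x => ENNReal.ofReal (1 - p + p * k x)) ≤
      ENNReal.ofReal (1 - p) • P +
        ENNReal.ofReal p • P.withDensity fun x => ENNReal.ofReal (h x) := by
  have hdensity (x : Ω) : ENNReal.ofReal (1 - p + p * k x) ≤
      ENNReal.ofReal (1 - p) + ENNReal.ofReal p * ENNReal.ofReal (h x) := by
    rw [← ENNReal.ofReal_mul hp0]
    refine (ENNReal.ofReal_le_ofReal ?_).trans ENNReal.ofReal_add_le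
    gcongr
    exact hk x
  calc _ ≤ P.withDensity fun x => ENNReal.ofReal (1 - p) +
          ENNReal.ofReal p * ENNReal.ofReal (h x) :=
        withDensity_mono (ae_of_all _ hdensity)
    _ = _ := by
        rw [show (fun x => ENNReal.ofReal (1 - p) + ENNReal.ofReal p * ENNReal.ofReal (h x)) =
          (fun _ => ENNReal.ofReal (1 - p)) + ENNReal.ofReal p • fun x => ENNReal.ofReal (h x)
          from rfl, withDensity_add_left measurable_const, withDensity_const,
          withDensity_smul' _ _ ENNReal.ofReal_ne_top]

variable [IsProbabilityMeasure P]

lemma isProbabilityMeasure_smul_add_smul {R : Measure Ω} [IsProbabilityMeasure R] (hp0 : 0 ≤ p)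
    (hp1 : p ≤ 1) :
    IsProbabilityMeasure (ENNReal.ofReal (1 - p) • P + ENNReal.ofReal p • R) := by
  constructor
  simp only [Measure.add_apply, Measure.smul_apply, measure_univ, smul_eq_mul, mul_one]
  rw [← ENNReal.ofReal_add (by linarith) hp0]
  simp

lemma integral_add_mul {k : Ω → ℝ} (hk : Integrable k P) :
    ∫ x, (1 - p + p * k x) ∂P = 1 - p * (1 - ∫ x, k x ∂P) := by
  rw [integral_add (integrable_const _) (hk.const_mul p), integral_const_mul]
  simp only [integral_const, probReal_univ, smul_eq_mul]
  ring

lemma integral_add_mul_sq_le {k : Ω → ℝ} (hk : MemLp k 2 P) (hk1 : ∫ x, k x ∂P ≤ 1) (hp0 : 0 ≤ p)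
    (hp1 : p ≤ 1) :
    ∫ x, (1 - p + p * k x) ^ 2 ∂P ≤ 1 + p ^ 2 * ∫ x, k x ^ 2 ∂P := by
  have hint : Integrable (fun x => 2 * (1 - p) * p * k x) P :=
    (hk.integrable one_le_two).const_mul _
  have hexpand (x : Ω) : (1 - p + p * k x) ^ 2 =
      (1 - p) ^ 2 + 2 * (1 - p) * p * k x + p ^ 2 * k x ^ 2 := by ring
  simp_rw [hexpand]
  rw [integral_add (f := fun x => (1 - p) ^ 2 + 2 * (1 - p) * p * k x)
      ((integrable_const _).add hint) (hk.integrable_sq.const_mul _),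
    integral_add (integrable_const _) hint, integral_const_mul, integral_const_mul]
  simp only [integral_const, probReal_univ, smul_eq_mul, one_mul]
  have hcross : 0 ≤ (1 - p) * p := mul_nonneg (by linarith) hp0
  nlinarith

-- Only the part of the contamination density that lives on `A` is kept in the second moment.
lemma tvDist_pi_contamination_le {ι : Type*} [Fintype ι] {h : Ω → ℝ} (h0 : ∀ x, 0 ≤ h x)
    (hint : Integrable h P)
    [IsProbabilityMeasure (P.withDensity fun x => ENNReal.ofReal (h x))] {A : Set Ω}
    (hA : MeasurableSet A) (hL2 : MemLp (A.indicator h) 2 P) (hp0 : 0 ≤ p) (hp1 : p ≤ 1) :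
    tvDist (Measure.pi fun _ : ι => P) (Measure.pi fun _ : ι => ENNReal.ofReal (1 - p) • P +
        ENNReal.ofReal p • P.withDensity fun x => ENNReal.ofReal (h x)) ≤
      √(2 * (Fintype.card ι * (p * (P.withDensity fun x => ENNReal.ofReal (h x)).real Aᶜ)) +
        (Real.exp (Fintype.card ι * (p ^ 2 * ∫ x in A, h x ^ 2 ∂P)) - 1)) := by
  set R := P.withDensity fun x => ENNReal.ofReal (h x) with hR
  set N := Fintype.card ι
  have := isProbabilityMeasure_smul_add_smul (P := P) (R := R) hp0 hp1
  have hk0 (x : Ω) : 0 ≤ A.indicator h x := Set.indicator_nonneg (fun x _ => h0 x) x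
  have hmean : ∫ x, A.indicator h x ∂P = 1 - R.real Aᶜ := by
    rw [integral_indicator hA, probReal_compl_eq_one_sub hA, sub_sub_cancel, Measure.real, hR,
      withDensity_apply _ hA, ← ofReal_integral_eq_lintegral_ofReal hint.integrableOn
        (ae_of_all _ h0), ENNReal.toReal_ofReal (integral_nonneg h0)]
  have hsq : ∫ x, A.indicator h x ^ 2 ∂P = ∫ x in A, h x ^ 2 ∂P := by
    rw [← integral_indicator hA]
    congr 1 with x
    by_cases hx : x ∈ A <;> simp [hx]
  have hmass0 : 0 ≤ R.real Aᶜ := measureReal_nonneg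
  have hmass1 : R.real Aᶜ ≤ 1 := measureReal_le_one
  have hfirst := integral_add_mul (p := p) (hL2.integrable one_le_two)
  have hsecond := integral_add_mul_sq_le hL2 (by linarith) hp0 hp1
  rw [hmean, sub_sub_cancel] at hfirst
  rw [hsq] at hsecond
  have hbernoulli : 1 + N * -(p * R.real Aᶜ) ≤ (1 + -(p * R.real Aᶜ)) ^ N :=
    one_add_mul_le_pow (by nlinarith) N
  have hexp : (∫ x, (1 - p + p * A.indicator h x) ^ 2 ∂P) ^ N ≤
      Real.exp (N * (p ^ 2 * ∫ x in A, h x ^ 2 ∂P)) := by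
    rw [Real.exp_nat_mul]
    gcongr
    linarith [Real.add_one_le_exp (p ^ 2 * ∫ x in A, h x ^ 2 ∂P)]
  refine (tvDist_pi_le_sqrt (fun x => add_nonneg (by linarith) (mul_nonneg hp0 (hk0 x)))
    ((memLp_const (1 - p)).add (hL2.const_mul p))
    (withDensity_ofReal_add_mul_le (Set.indicator_le_self' fun x _ => h0 x) hp0)).trans ?_
  refine Real.sqrt_le_sqrt ?_
  rw [hfirst, sub_eq_add_neg (1 : ℝ) (p * _)]
  linarith

end Contamination

section LikelihoodRatio

/-- The density of the law of `μ + Z`, where `μ ∼ ν` and `Z` is an independent standard normal,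
relative to the standard normal law. -/
def likelihoodRatio (ν : Measure ℝ) (x : ℝ) : ℝ :=
  ∫ m, Real.exp (m * x - m ^ 2 / 2) ∂ν

variable (ν : Measure ℝ)

lemma integrable_exp_mul_sub_sq_div_two [IsFiniteMeasure ν] (x : ℝ) :
    Integrable (fun m : ℝ => Real.exp (m * x - m ^ 2 / 2)) ν := by
  refine Integrable.of_bound (by fun_prop) (Real.exp (x ^ 2 / 2)) (ae_of_all _ fun m => ?_)
  rw [Real.norm_of_nonneg (Real.exp_pos _).le]
  gcongr; nlinarith [sq_nonneg (m - x)]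

lemma likelihoodRatio_nonneg (x : ℝ) : 0 ≤ likelihoodRatio ν x :=
  integral_nonneg fun _ => (Real.exp_pos _).le

lemma measurable_likelihoodRatio [SFinite ν] : Measurable (likelihoodRatio ν) :=
  (StronglyMeasurable.integral_prod_left' (f := fun p : ℝ × ℝ =>
    Real.exp (p.1 * p.2 - p.1 ^ 2 / 2))
    (Measurable.stronglyMeasurable (by fun_prop))).measurable

lemma gaussianPDF_eq_mul (m x : ℝ) :
    gaussianPDF m 1 x =
      gaussianPDF 0 1 x * ENNReal.ofReal (Real.exp (m * x - m ^ 2 / 2)) := by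
  rw [gaussianPDF, gaussianPDF, ← ENNReal.ofReal_mul (gaussianPDFReal_nonneg _ _ _),
    gaussianPDFReal_zero_one, mul_assoc, ← Real.exp_add]
  simp only [gaussianPDFReal, NNReal.coe_one, mul_one]
  congr 3; ring

lemma gaussianReal_apply_eq_setLIntegral (m : ℝ) {s : Set ℝ} (hs : MeasurableSet s) :
    gaussianReal m 1 s =
      ∫⁻ x in s, ENNReal.ofReal (Real.exp (m * x - m ^ 2 / 2)) ∂gaussianReal 0 1 := by
  rw [gaussianReal_apply _ one_ne_zero, gaussianReal_of_var_ne_zero _ one_ne_zero,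
    setLIntegral_withDensity_eq_setLIntegral_mul _ (measurable_gaussianPDF 0 1) (by fun_prop) hs]
  simp_rw [gaussianPDF_eq_mul m]
  rfl

lemma gaussianMixture_eq_withDensity [IsFiniteMeasure ν] :
    gaussianMixture ν =
      (gaussianReal 0 1).withDensity fun x => ENNReal.ofReal (likelihoodRatio ν x) := by
  ext s hs
  have hdensity (x : ℝ) : ENNReal.ofReal (likelihoodRatio ν x) =
      ∫⁻ m, ENNReal.ofReal (Real.exp (m * x - m ^ 2 / 2)) ∂ν :=
    ofReal_integral_eq_lintegral_ofReal (integrable_exp_mul_sub_sq_div_two ν x)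
      (ae_of_all _ fun m => (Real.exp_pos _).le)
  rw [gaussianMixture_apply ν hs, withDensity_apply _ hs]
  simp_rw [hdensity, gaussianReal_apply_eq_setLIntegral _ hs]
  exact lintegral_lintegral_swap (by fun_prop)

lemma likelihoodRatio_le_exp [IsProbabilityMeasure ν] (x : ℝ) :
    likelihoodRatio ν x ≤ Real.exp (x ^ 2 / 2) := by
  have hmono := integral_mono (integrable_exp_mul_sub_sq_div_two ν x)
    (integrable_const (Real.exp (x ^ 2 / 2)))
    fun m => Real.exp_le_exp.2 (by nlinarith [sq_nonneg (m - x)] : m * x - m ^ 2 / 2 ≤ x ^ 2 / 2)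
  simpa [likelihoodRatio] using hmono

lemma integrable_likelihoodRatio [IsProbabilityMeasure ν] :
    Integrable (likelihoodRatio ν) (gaussianReal 0 1) := by
  refine ⟨(measurable_likelihoodRatio ν).aestronglyMeasurable, ?_⟩
  rw [hasFiniteIntegral_iff_ofReal (ae_of_all _ (likelihoodRatio_nonneg ν)),
    ← setLIntegral_univ, ← withDensity_apply _ MeasurableSet.univ,
    ← gaussianMixture_eq_withDensity]
  exact measure_lt_top _ _

lemma memLp_indicator_likelihoodRatio [IsProbabilityMeasure ν] (r : ℝ) :
    MemLp ({x | |x| ≤ r}.indicator (likelihoodRatio ν)) 2 (gaussianReal 0 1) := by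
  have hmeas : MeasurableSet {x : ℝ | |x| ≤ r} := measurableSet_le (by fun_prop) measurable_const
  refine MemLp.of_bound
    ((measurable_likelihoodRatio ν).indicator hmeas).aestronglyMeasurable
    (Real.exp (r ^ 2 / 2)) (ae_of_all _ fun x => ?_)
  by_cases hx : |x| ≤ r
  · rw [Set.indicator_of_mem (by exact hx), Real.norm_of_nonneg (likelihoodRatio_nonneg ν x)]
    refine (likelihoodRatio_le_exp ν x).trans ?_
    have := sq_le_sq.2 (hx.trans (le_abs_self r))
    gcongr
  · rw [Set.indicator_of_notMem (by exact hx), norm_zero]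
    positivity

-- The shift `m` contributes at most `exp (x ^ 2 / 2) * exp (-(|x| - |m|) ^ 2 / 2)`, whose last
-- factor is comparable to `P(|m + Z| > |x|)`.
lemma likelihoodRatio_le [IsProbabilityMeasure ν] (x : ℝ) :
    likelihoodRatio ν x ≤ gaussianTailConst * (1 + |x|) *
      (Real.exp (x ^ 2 / 2) * absTail (gaussianMixture ν) |x|) := by
  have hconst := gaussianTailConst_pos
  have hshift (m : ℝ) : Real.exp (m * x - m ^ 2 / 2) ≤ gaussianTailConst * (1 + |x|) *
      (Real.exp (x ^ 2 / 2) * absTail (gaussianReal m 1) |x|) := by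
    calc Real.exp (m * x - m ^ 2 / 2)
        ≤ Real.exp (x ^ 2 / 2) * Real.exp (-(|x| - |m|) ^ 2 / 2) := by
          rw [← Real.exp_add]
          gcongr
          have := le_abs_self (m * x)
          rw [abs_mul] at this
          nlinarith [sq_abs x, sq_abs m]
      _ ≤ Real.exp (x ^ 2 / 2) *
          (gaussianTailConst * (1 + |x|) * absTail (gaussianReal m 1) |x|) := by
          gcongr
          refine (exp_neg_sq_div_two_le_mul_gaussianTail (abs_nonneg x)
            (sub_le_self _ (abs_nonneg m))).trans ?_
          gcongr
          exact gaussianTail_le_absTail_gaussianReal m |x|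
      _ = _ := by ring
  rw [absTail_gaussianMixture, likelihoodRatio, ← integral_const_mul, ← integral_const_mul]
  exact integral_mono (integrable_exp_mul_sub_sq_div_two ν x)
    (((integrable_absTail_gaussianReal ν |x|).const_mul _).const_mul _) hshift

lemma gaussianPDFReal_mul_likelihoodRatio_sq_le [IsProbabilityMeasure ν] (x : ℝ) :
    gaussianPDFReal 0 1 x * likelihoodRatio ν x ^ 2 ≤ gaussianTailConst ^ 2 * (1 + |x|) ^ 2 *
      (Real.exp (|x| ^ 2 / 2) * absTail (gaussianMixture ν) |x| ^ 2) := by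
  have hpdf : gaussianPDFReal 0 1 x ≤ Real.exp (-x ^ 2 / 2) := by
    rw [gaussianPDFReal_zero_one]
    refine mul_le_of_le_one_left (Real.exp_pos _).le (inv_le_one_of_one_le₀ ?_)
    rw [Real.one_le_sqrt]; nlinarith [Real.pi_gt_three]
  have hexp : Real.exp (-x ^ 2 / 2) * Real.exp (x ^ 2 / 2) = 1 := by
    rw [← Real.exp_add, ← Real.exp_zero]; congr 1; ring
  calc gaussianPDFReal 0 1 x * likelihoodRatio ν x ^ 2
      ≤ Real.exp (-x ^ 2 / 2) * (gaussianTailConst * (1 + |x|) *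
          (Real.exp (x ^ 2 / 2) * absTail (gaussianMixture ν) |x|)) ^ 2 := by
        gcongr
        · exact likelihoodRatio_nonneg ν x
        · exact likelihoodRatio_le ν x
    _ = Real.exp (-x ^ 2 / 2) * Real.exp (x ^ 2 / 2) * (gaussianTailConst ^ 2 * (1 + |x|) ^ 2 *
          (Real.exp (x ^ 2 / 2) * absTail (gaussianMixture ν) |x| ^ 2)) := by ring
    _ = _ := by rw [hexp, one_mul, sq_abs]

lemma setIntegral_gaussianReal_eq (f : ℝ → ℝ) {s : Set ℝ} (hs : MeasurableSet s) :
    ∫ x in s, f x ∂gaussianReal 0 1 = ∫ x in s, gaussianPDFReal 0 1 x * f x := by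
  rw [gaussianReal_of_var_ne_zero _ one_ne_zero,
    setIntegral_withDensity_eq_setIntegral_toReal_smul (measurable_gaussianPDF 0 1)
      (ae_of_all _ fun x => gaussianPDF_lt_top) _ hs]
  simp only [toReal_gaussianPDF, smul_eq_mul]

lemma setIntegral_likelihoodRatio_sq_le [IsProbabilityMeasure ν] {r B : ℝ} (hr : 0 ≤ r)
    (hB : ∀ x ∈ Set.Icc 0 r, Real.exp (x ^ 2 / 2) * absTail (gaussianMixture ν) x ^ 2 ≤ B) :
    ∫ x in {x | |x| ≤ r}, likelihoodRatio ν x ^ 2 ∂gaussianReal 0 1 ≤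
      2 * gaussianTailConst ^ 2 * (1 + r) ^ 3 * B := by
  have hB0 : 0 ≤ B := le_trans (by positivity) (hB 0 ⟨le_rfl, hr⟩)
  have hIcc : {x : ℝ | |x| ≤ r} = Set.Icc (-r) r := by ext; simp [abs_le]
  have hbound : ∀ x ∈ Set.Icc (-r) r, gaussianPDFReal 0 1 x * likelihoodRatio ν x ^ 2 ≤
      gaussianTailConst ^ 2 * (1 + r) ^ 2 * B := by
    intro x hx
    have hxr : |x| ≤ r := abs_le.2 hx
    refine (gaussianPDFReal_mul_likelihoodRatio_sq_le ν x).trans ?_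
    gcongr
    exact hB |x| ⟨abs_nonneg x, hxr⟩
  calc ∫ x in {x | |x| ≤ r}, likelihoodRatio ν x ^ 2 ∂gaussianReal 0 1
      = ∫ x in Set.Icc (-r) r, gaussianPDFReal 0 1 x * likelihoodRatio ν x ^ 2 := by
        rw [hIcc, setIntegral_gaussianReal_eq _ measurableSet_Icc]
    _ ≤ ∫ _x in Set.Icc (-r) r, gaussianTailConst ^ 2 * (1 + r) ^ 2 * B :=
        integral_mono_of_nonneg
          (ae_of_all _ fun x => mul_nonneg (gaussianPDFReal_nonneg _ _ _) (sq_nonneg _))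
          (integrable_const _) ((ae_restrict_iff' measurableSet_Icc).2 (ae_of_all _ hbound))
    _ = 2 * r * (gaussianTailConst ^ 2 * (1 + r) ^ 2 * B) := by
        rw [setIntegral_const, Real.volume_real_Icc_of_le (by linarith), smul_eq_mul]; ring
    _ ≤ 2 * (1 + r) * (gaussianTailConst ^ 2 * (1 + r) ^ 2 * B) := by gcongr; linarith
    _ = _ := by ring

end LikelihoodRatio

section SparseLaws

lemma natCast_rpow_neg_le_one (n : ℕ) {β : ℝ} (hβ : 0 ≤ β) : (n : ℝ) ^ (-β) ≤ 1 := by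
  rcases n.eq_zero_or_pos with rfl | hn
  · simpa using Real.zero_rpow_le_one (-β)
  · exact Real.rpow_le_one_of_one_le_of_nonpos (by exact_mod_cast hn) (by linarith)

lemma isProbabilityMeasure_prior (ν : Measure ℝ) [IsProbabilityMeasure ν] (n : ℕ) {β : ℝ}
    (hβ : 0 ≤ β) : IsProbabilityMeasure (prior ν n β) :=
  isProbabilityMeasure_smul_add_smul (by positivity) (natCast_rpow_neg_le_one n hβ)

lemma gaussianMixture_prior (ν : Measure ℝ) [SFinite ν] (n : ℕ) (β : ℝ) :
    gaussianMixture (prior ν n β) = ENNReal.ofReal (1 - (n : ℝ) ^ (-β)) • gaussianReal 0 1 +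
      ENNReal.ofReal ((n : ℝ) ^ (-β)) • gaussianMixture ν :=
  gaussianMixture_smul_dirac_add_smul ν _ _

instance isProbabilityMeasure_nullLaw (n : ℕ) : IsProbabilityMeasure (nullLaw n) := by
  unfold nullLaw; infer_instance

variable (G : ℕ → Measure ℝ) [∀ n, IsProbabilityMeasure (G n)]

lemma isProbabilityMeasure_altLaw (n : ℕ) {β : ℝ} (hβ : 0 ≤ β) :
    IsProbabilityMeasure (altLaw G β n) := by
  have := isProbabilityMeasure_prior (G n) n hβ
  unfold altLaw; infer_instance

lemma tvDist_nullLaw_altLaw_le (n : ℕ) {β : ℝ} (hβ : 0 ≤ β) (r : ℝ) :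
    tvDist (nullLaw n) (altLaw G β n) ≤
      √(2 * (n * ((n : ℝ) ^ (-β) * absTail (gaussianMixture (G n)) r)) +
        (Real.exp (n * (((n : ℝ) ^ (-β)) ^ 2 *
          ∫ x in {x | |x| ≤ r}, likelihoodRatio (G n) x ^ 2 ∂gaussianReal 0 1)) - 1)) := by
  have hmix := gaussianMixture_eq_withDensity (G n)
  have : IsProbabilityMeasure ((gaussianReal 0 1).withDensity fun x =>
      ENNReal.ofReal (likelihoodRatio (G n) x)) := hmix ▸ inferInstance
  have hcompl : {x : ℝ | |x| ≤ r}ᶜ = {x | r < |x|} := by ext; simp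
  have hmain := tvDist_pi_contamination_le (ι := Fin n) (likelihoodRatio_nonneg (G n))
    (integrable_likelihoodRatio (G n)) (measurableSet_le (by fun_prop) measurable_const)
    (memLp_indicator_likelihoodRatio (G n) r) (by positivity) (natCast_rpow_neg_le_one n hβ)
  rwa [hcompl, ← hmix, ← gaussianMixture_prior, Fintype.card_fin] at hmain

end SparseLaws

section Scaling

/-- The universal threshold `√(2 log n)` of Donoho and Johnstone, which is the asymptotic size of
the maximum of `n` standard Gaussian variables in absolute value. -/
def universalThreshold (n : ℕ) : ℝ :=
  √(2 * Real.log n)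

lemma universalThreshold_nonneg (n : ℕ) : 0 ≤ universalThreshold n :=
  Real.sqrt_nonneg _

lemma tendsto_log_natCast_atTop : Tendsto (fun n : ℕ => Real.log n) atTop atTop :=
  Real.tendsto_log_atTop.comp tendsto_natCast_atTop_atTop

lemma tendsto_natCast_rpow_neg {s : ℝ} (hs : 0 < s) :
    Tendsto (fun n : ℕ => (n : ℝ) ^ (-s)) atTop (𝓝 0) :=
  (tendsto_rpow_neg_atTop hs).comp tendsto_natCast_atTop_atTop

lemma tendsto_universalThreshold_atTop : Tendsto universalThreshold atTop atTop :=
  Real.tendsto_sqrt_atTop.comp (tendsto_log_natCast_atTop.const_mul_atTop two_pos)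

lemma universalThreshold_sq (n : ℕ) : universalThreshold n ^ 2 = 2 * Real.log n :=
  Real.sq_sqrt (mul_nonneg zero_le_two (Real.log_natCast_nonneg n))

lemma exp_mul_universalThreshold_sq {n : ℕ} (hn : 1 ≤ n) (c u : ℝ) :
    Real.exp (c * (u * universalThreshold n) ^ 2 / 2) = (n : ℝ) ^ (c * u ^ 2) := by
  rw [Real.rpow_def_of_pos (by exact_mod_cast hn), mul_pow, universalThreshold_sq]
  congr 1; ring

lemma tendsto_one_add_universalThreshold_mul_rpow_neg {s : ℝ} (hs : 0 < s) :
    Tendsto (fun n : ℕ => (1 + universalThreshold n) * (n : ℝ) ^ (-s)) atTop (𝓝 0) := by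
  have hlog : Tendsto (fun n : ℕ => Real.log n / (n : ℝ) ^ s) atTop (𝓝 0) :=
    (isLittleO_log_rpow_atTop hs).tendsto_div_nhds_zero.comp tendsto_natCast_atTop_atTop
  have hsum : Tendsto (fun n : ℕ => (2 + Real.log n) * (n : ℝ) ^ (-s)) atTop (𝓝 0) := by
    simpa [add_mul, Real.rpow_neg, div_eq_mul_inv] using
      ((tendsto_natCast_rpow_neg hs).const_mul 2).add hlog
  refine squeeze_zero (fun n => mul_nonneg ?_ (by positivity)) (fun n => ?_) hsum
  · linarith [universalThreshold_nonneg n]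
  · refine mul_le_mul_of_nonneg_right ?_ (by positivity)
    nlinarith [universalThreshold_sq n, sq_nonneg (universalThreshold n - 1)]

lemma tendsto_one_add_universalThreshold_pow_mul_rpow_neg {k : ℕ} (hk : k ≠ 0) {s : ℝ}
    (hs : 0 < s) :
    Tendsto (fun n : ℕ => (1 + universalThreshold n) ^ k * (n : ℝ) ^ (-s)) atTop (𝓝 0) := by
  have hk0 : (0 : ℝ) < k := by positivity
  have hpow := (tendsto_one_add_universalThreshold_mul_rpow_neg (div_pos hs hk0)).pow k
  rw [zero_pow hk] at hpow
  refine hpow.congr fun n => ?_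
  rw [mul_pow, ← Real.rpow_natCast ((n : ℝ) ^ _), ← Real.rpow_mul n.cast_nonneg]
  congr 2; field_simp

end Scaling

section Tau

variable (G : ℕ → Measure ℝ) [∀ n, IsProbabilityMeasure (G n)]

lemma natCast_rpow_tau {n : ℕ} (hn : 2 ≤ n) {d : ℝ} (hd : 0 ≤ d) :
    (n : ℝ) ^ tau G n (d ^ 2) = absTail (gaussianMixture (G n)) (d * universalThreshold n) := by
  have hn' : (1 : ℝ) < n := by exact_mod_cast hn
  have hthreshold : √(2 * d ^ 2 * Real.log n) = d * universalThreshold n := by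
    rw [mul_comm 2, mul_assoc, Real.sqrt_mul (sq_nonneg d), Real.sqrt_sq hd, universalThreshold]
  rw [tau, hthreshold]
  exact Real.rpow_logb (by linarith) hn'.ne' (absTail_gaussianMixture_pos (G n) _)

lemma natCast_rpow_tau_one {n : ℕ} (hn : 2 ≤ n) :
    (n : ℝ) ^ tau G n 1 = absTail (gaussianMixture (G n)) (universalThreshold n) := by
  simpa only [one_pow, one_mul] using natCast_rpow_tau G hn zero_le_one

lemma tau_nonpos (n : ℕ) (δ : ℝ) : tau G n δ ≤ 0 :=
  div_nonpos_of_nonpos_of_nonneg (Real.log_nonpos measureReal_nonneg measureReal_le_one)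
    (Real.log_natCast_nonneg n)

lemma antitone_tau (n : ℕ) : Antitone (tau G n) := fun δ δ' h => by
  refine div_le_div_of_nonneg_right (Real.log_le_log (absTail_gaussianMixture_pos (G n) _)
    (antitone_absTail _ (Real.sqrt_le_sqrt ?_))) (Real.log_natCast_nonneg n)
  have := Real.log_natCast_nonneg n
  gcongr

end Tau

section Undetectability

variable (G : ℕ → Measure ℝ)

/-- The detection exponents `τ_n(δ) + δ / 2` are asymptotically at most `M`, uniformly in
`δ ∈ [0, 1]`. The sparse alternatives with `β > 1 / 2 + M` are then undetectable. -/
def DetectionExponentLE (M : ℝ) : Prop :=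
  ∀ ε > 0, ∀ᶠ n in atTop, ∀ δ ∈ Set.Icc (0 : ℝ) 1, tau G n δ + δ / 2 ≤ M + ε

variable {G} [∀ n, IsProbabilityMeasure (G n)]

-- Since `τ_n` is antitone, its values on a fine grid control it on all of `[0, 1]`.
lemma detectionExponentLE_of_tendsto {τ : ℝ → ℝ} {M : ℝ}
    (hτ : ∀ δ ∈ Set.Icc (0 : ℝ) 1, Tendsto (fun n => tau G n δ) atTop (𝓝 (τ δ)))
    (hM : ∀ δ ∈ Set.Icc (0 : ℝ) 1, τ δ + δ / 2 ≤ M) : DetectionExponentLE G M := by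
  intro ε hε
  obtain ⟨K, hK⟩ := exists_nat_gt ε⁻¹
  have hK0 : (0 : ℝ) < K := (inv_pos.2 hε).trans hK
  have hmesh : (K : ℝ)⁻¹ < ε := inv_lt_of_inv_lt₀ hε hK
  have hgrid : ∀ᶠ n in atTop, ∀ k ∈ Finset.range (K + 1),
      tau G n (k / K) < τ (k / K) + ε / 2 := by
    refine (Finset.eventually_all _).2 fun k hk => ?_
    have hkK : (k : ℝ) ≤ K := by exact_mod_cast Finset.mem_range_succ_iff.1 hk
    exact (hτ _ ⟨by positivity, (div_le_one hK0).2 hkK⟩).eventually_lt_const (by linarith)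
  filter_upwards [hgrid] with n hn δ hδ
  set k := ⌊δ * K⌋₊
  have hk_le : (k : ℝ) ≤ δ * K := Nat.floor_le (mul_nonneg hδ.1 hK0.le)
  have hlt_k : δ * K < k + 1 := Nat.lt_floor_add_one _
  have hkK : (k : ℝ) ≤ K := hk_le.trans (mul_le_of_le_one_left hK0.le hδ.2)
  have hkδ : (k : ℝ) / K ≤ δ := (div_le_iff₀ hK0).2 hk_le
  have hδk : δ < k / K + (K : ℝ)⁻¹ := by
    rw [inv_eq_one_div, ← add_div]; exact (lt_div_iff₀ hK0).2 hlt_k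
  have htau := hn k (Finset.mem_range_succ_iff.2 (by exact_mod_cast hkK))
  have hMk := hM (k / K) ⟨by positivity, (div_le_one hK0).2 hkK⟩
  linarith [antitone_tau G n hkδ]

lemma setIntegral_likelihoodRatio_sq_le_rpow {n : ℕ} (hn : 2 ≤ n) {s : ℝ}
    (hs : ∀ δ ∈ Set.Icc (0 : ℝ) 1, tau G n δ + δ / 2 ≤ s) :
    ∫ x in {x | |x| ≤ universalThreshold n}, likelihoodRatio (G n) x ^ 2 ∂gaussianReal 0 1 ≤
      2 * gaussianTailConst ^ 2 * (1 + universalThreshold n) ^ 3 * (n : ℝ) ^ (2 * s) := by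
  have hn' : (1 : ℝ) < n := by exact_mod_cast hn
  have hr : 0 < universalThreshold n :=
    Real.sqrt_pos.2 (mul_pos two_pos (Real.log_pos hn'))
  refine setIntegral_likelihoodRatio_sq_le (G n) hr.le fun x hx => ?_
  obtain ⟨d, hd, rfl⟩ : ∃ d ∈ Set.Icc (0 : ℝ) 1, x = d * universalThreshold n :=
    ⟨x / universalThreshold n, ⟨div_nonneg hx.1 hr.le, div_le_one_of_le₀ hx.2 hr.le⟩,
      (div_mul_cancel₀ x hr.ne').symm⟩
  have hexp := exp_mul_universalThreshold_sq (by lia : 1 ≤ n) 1 d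
  rw [one_mul, one_mul] at hexp
  rw [hexp, ← natCast_rpow_tau G hn hd.1, ← Real.rpow_mul_natCast n.cast_nonneg,
    ← Real.rpow_add (by linarith)]
  refine Real.rpow_le_rpow_of_exponent_le hn'.le ?_
  have := hs (d ^ 2) ⟨sq_nonneg d, pow_le_one₀ hd.1 hd.2⟩
  push_cast; linarith

lemma tvDist_nullLaw_altLaw_le_of_tau_le {n : ℕ} (hn : 2 ≤ n) {β ε : ℝ} (hβ : 0 ≤ β)
    (hτ : ∀ δ ∈ Set.Icc (0 : ℝ) 1, tau G n δ + δ / 2 ≤ β - 1 / 2 - ε) :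
    tvDist (nullLaw n) (altLaw G β n) ≤ √(2 * (n : ℝ) ^ (-ε) +
      (Real.exp (2 * gaussianTailConst ^ 2 * ((1 + universalThreshold n) ^ 3 *
        (n : ℝ) ^ (-(2 * ε)))) - 1)) := by
  have hn' : (1 : ℝ) < n := by exact_mod_cast hn
  have hn0 : (0 : ℝ) < n := by linarith
  have htail : n * ((n : ℝ) ^ (-β) * absTail (gaussianMixture (G n)) (universalThreshold n)) ≤
      (n : ℝ) ^ (-ε) := by
    rw [← natCast_rpow_tau_one G hn, ← Real.rpow_add hn0]
    nth_rewrite 1 [← Real.rpow_one (n : ℝ)]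
    rw [← Real.rpow_add hn0]
    exact Real.rpow_le_rpow_of_exponent_le hn'.le (by linarith [hτ 1 ⟨zero_le_one, le_rfl⟩])
  have hpow : n * ((n : ℝ) ^ (-β)) ^ 2 * (n : ℝ) ^ (2 * (β - 1 / 2 - ε)) =
      (n : ℝ) ^ (-(2 * ε)) := by
    rw [← Real.rpow_mul_natCast hn0.le]
    nth_rewrite 1 [← Real.rpow_one (n : ℝ)]
    rw [← Real.rpow_add hn0, ← Real.rpow_add hn0]
    congr 1; push_cast; ring
  have hbulk : n * (((n : ℝ) ^ (-β)) ^ 2 *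
      ∫ x in {x | |x| ≤ universalThreshold n}, likelihoodRatio (G n) x ^ 2 ∂gaussianReal 0 1) ≤
      2 * gaussianTailConst ^ 2 * ((1 + universalThreshold n) ^ 3 * (n : ℝ) ^ (-(2 * ε))) := by
    rw [← hpow]
    refine (mul_le_mul_of_nonneg_left (mul_le_mul_of_nonneg_left
      (setIntegral_likelihoodRatio_sq_le_rpow hn hτ) (by positivity)) hn0.le).trans_eq ?_
    ring
  refine (tvDist_nullLaw_altLaw_le G n hβ (universalThreshold n)).trans ?_
  gcongr

theorem tendsto_tvDist_zero {M β : ℝ} (hM : DetectionExponentLE G M) (hβ0 : 0 ≤ β)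
    (hβ : 1 / 2 + M < β) :
    Tendsto (fun n => tvDist (nullLaw n) (altLaw G β n)) atTop (𝓝 0) := by
  obtain ⟨ε, hε, rfl⟩ : ∃ ε > 0, β = 1 / 2 + M + 2 * ε :=
    ⟨(β - 1 / 2 - M) / 2, by linarith, by ring⟩
  have hbound : Tendsto (fun n : ℕ => √(2 * (n : ℝ) ^ (-ε) +
      (Real.exp (2 * gaussianTailConst ^ 2 * ((1 + universalThreshold n) ^ 3 *
        (n : ℝ) ^ (-(2 * ε)))) - 1))) atTop (𝓝 0) := by
    have hbulk := (tendsto_one_add_universalThreshold_pow_mul_rpow_neg three_ne_zero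
      (mul_pos two_pos hε)).const_mul (2 * gaussianTailConst ^ 2)
    have hsum := ((tendsto_natCast_rpow_neg hε).const_mul 2).add (hbulk.rexp.sub_const 1)
    simpa using hsum.sqrt
  refine squeeze_zero' (Eventually.of_forall fun n => ?_) ?_ hbound
  · have := isProbabilityMeasure_altLaw G n hβ0
    exact tvDist_nonneg _ _
  · filter_upwards [eventually_ge_atTop 2, hM ε hε] with n hn hτ
    exact tvDist_nullLaw_altLaw_le_of_tau_le hn hβ0 fun δ hδ => (hτ δ hδ).trans (by linarith)

end Undetectability

section MaxTest

lemma maxStat_le_iff {n : ℕ} (hn : 1 ≤ n) (x : Fin n → ℝ) (t : ℝ) :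
    maxStat x ≤ t ↔ ∀ i, |x i| ≤ t := by
  have : Nonempty (Fin n) := ⟨⟨0, hn⟩⟩
  exact ciSup_le_iff (Set.finite_range _).bddAbove

lemma setOf_maxStat_le {n : ℕ} (hn : 1 ≤ n) (t : ℝ) :
    {x : Fin n → ℝ | maxStat x ≤ t} = Set.univ.pi fun _ => {y : ℝ | |y| ≤ t} := by
  ext x; simp [maxStat_le_iff hn]

lemma measurableSet_maxStat_le {n : ℕ} (hn : 1 ≤ n) (t : ℝ) :
    MeasurableSet {x : Fin n → ℝ | maxStat x ≤ t} := by
  rw [setOf_maxStat_le hn]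
  exact MeasurableSet.univ_pi fun _ => measurableSet_le (by fun_prop) measurable_const

lemma pi_real_maxStat_le (P : Measure ℝ) [IsProbabilityMeasure P] {n : ℕ} (hn : 1 ≤ n) (t : ℝ) :
    (Measure.pi fun _ : Fin n => P).real {x | maxStat x ≤ t} = (1 - absTail P t) ^ n := by
  have hcompl : {y : ℝ | |y| ≤ t} = {y | t < |y|}ᶜ := by ext; simp
  rw [setOf_maxStat_le hn, Measure.real, Measure.pi_pi, Finset.prod_const, ENNReal.toReal_pow,
    Finset.card_univ, Fintype.card_fin, absTail, ← probReal_compl_eq_one_sub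
    (measurableSet_lt_abs t), hcompl, Measure.real]

lemma natCast_rpow_neg_mul_absTail_le_absTail_prior (ν : Measure ℝ) [IsProbabilityMeasure ν]
    (n : ℕ) (β t : ℝ) : (n : ℝ) ^ (-β) * absTail (gaussianMixture ν) t ≤
      absTail (gaussianMixture (prior ν n β)) t := by
  have := Measure.smul_finite (gaussianReal 0 1) (ENNReal.ofReal_ne_top (r := 1 - (n : ℝ) ^ (-β)))
  have := Measure.smul_finite (gaussianMixture ν) (ENNReal.ofReal_ne_top (r := (n : ℝ) ^ (-β)))
  simp only [gaussianMixture_prior, absTail]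
  rw [measureReal_add_apply, measureReal_ennreal_smul_apply, measureReal_ennreal_smul_apply,
    ENNReal.toReal_ofReal (by positivity : 0 ≤ (n : ℝ) ^ (-β))]
  exact le_add_of_nonneg_left (by positivity)

lemma one_sub_mul_absTail_le_nullLaw_real {n : ℕ} (hn : 1 ≤ n) (t : ℝ) :
    1 - n * absTail (gaussianReal 0 1) t ≤ (nullLaw n).real {x | maxStat x ≤ t} := by
  rw [nullLaw, pi_real_maxStat_le _ hn, sub_eq_add_neg, sub_eq_add_neg, ← mul_neg]
  exact one_add_mul_le_pow (by linarith [absTail_le_one (gaussianReal 0 1) t]) n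

lemma maxCritVal_le {n : ℕ} (hn : 1 ≤ n) {α t : ℝ} (hα : α < 1)
    (ht : n * absTail (gaussianReal 0 1) t ≤ α) : maxCritVal n α ≤ t := by
  refine csInf_le ⟨0, fun s (hs : 1 - α ≤ _) => ?_⟩
    ((sub_le_sub_left ht 1).trans (one_sub_mul_absTail_le_nullLaw_real hn t))
  by_contra! hneg
  have hempty : {x : Fin n → ℝ | maxStat x ≤ s} = ∅ :=
    Set.eq_empty_of_forall_notMem fun x hx =>
      ((abs_nonneg _).trans ((maxStat_le_iff hn x s).1 hx ⟨0, hn⟩)).not_gt hneg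
  rw [hempty, measureReal_empty] at hs
  linarith

lemma tendsto_mul_absTail_gaussianReal :
    Tendsto (fun n : ℕ => n * absTail (gaussianReal 0 1) (universalThreshold n)) atTop (𝓝 0) := by
  have hlim : Tendsto (fun n : ℕ => 2 / universalThreshold n) atTop (𝓝 0) :=
    tendsto_const_nhds.div_atTop tendsto_universalThreshold_atTop
  refine squeeze_zero' (Eventually.of_forall fun n =>
    mul_nonneg n.cast_nonneg (absTail_nonneg _ _)) ?_ hlim
  filter_upwards [eventually_ge_atTop 1, tendsto_universalThreshold_atTop.eventually_gt_atTop 0]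
    with n hn hr
  have hn0 : (0 : ℝ) < n := by exact_mod_cast hn
  have htail := absTail_gaussianReal_le 0 (universalThreshold n)
  rw [abs_zero, sub_zero] at htail
  have hexp : Real.exp (-universalThreshold n ^ 2 / 2) = (n : ℝ)⁻¹ := by
    rw [universalThreshold_sq, neg_div, mul_div_cancel_left₀ _ two_ne_zero, Real.exp_neg,
      Real.exp_log hn0]
  calc n * absTail (gaussianReal 0 1) (universalThreshold n)
      ≤ n * (2 * (Real.exp (-universalThreshold n ^ 2 / 2) / universalThreshold n)) := by
        gcongr
        exact htail.trans (by gcongr; exact gaussianTail_le_exp_div hr)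
    _ = 2 / universalThreshold n := by rw [hexp]; field_simp

lemma tendsto_nullLaw_real_maxStat_le :
    Tendsto (fun n => (nullLaw n).real {x | maxStat x ≤ universalThreshold n}) atTop (𝓝 1) := by
  have h := tendsto_mul_absTail_gaussianReal.const_sub 1
  rw [sub_zero] at h
  refine tendsto_of_tendsto_of_tendsto_of_le_of_le' h tendsto_const_nhds ?_
    (Eventually.of_forall fun n => measureReal_le_one)
  filter_upwards [eventually_ge_atTop 1] with n hn
  exact one_sub_mul_absTail_le_nullLaw_real hn _

variable (G : ℕ → Measure ℝ) [∀ n, IsProbabilityMeasure (G n)] {b β : ℝ}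

lemma altLaw_real_maxStat_le_exp {n : ℕ} (hn : 1 ≤ n) (hβ : 0 ≤ β) (t : ℝ) :
    (altLaw G β n).real {x | maxStat x ≤ t} ≤
      Real.exp (-(n * ((n : ℝ) ^ (-β) * absTail (gaussianMixture (G n)) t))) := by
  have := isProbabilityMeasure_prior (G n) n hβ
  rw [altLaw, pi_real_maxStat_le _ hn]
  set q := absTail (gaussianMixture (prior (G n) n β)) t
  have hq : q ≤ 1 := absTail_le_one _ t
  calc (1 - q) ^ n ≤ Real.exp (-q) ^ n := by
        have := Real.one_sub_le_exp_neg q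
        gcongr
    _ = Real.exp (-(n * q)) := by rw [← Real.exp_nat_mul, mul_neg]
    _ ≤ _ := by gcongr; exact natCast_rpow_neg_mul_absTail_le_absTail_prior (G n) n β t

variable {G}

lemma tendsto_altLaw_real_maxStat_le (hτ : Tendsto (fun n => tau G n 1) atTop (𝓝 b))
    (hβ0 : 0 ≤ β) (hβ : β < 1 + b) :
    Tendsto (fun n => (altLaw G β n).real {x | maxStat x ≤ universalThreshold n})
      atTop (𝓝 0) := by
  obtain ⟨c, hc, rfl⟩ : ∃ c > 0, β = 1 + b - 2 * c := ⟨(1 + b - β) / 2, by linarith, by ring⟩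
  have hlim : Tendsto (fun n : ℕ => Real.exp (-(n : ℝ) ^ c)) atTop (𝓝 0) :=
    Real.tendsto_exp_neg_atTop_nhds_zero.comp
      ((tendsto_rpow_atTop hc).comp tendsto_natCast_atTop_atTop)
  refine squeeze_zero' (Eventually.of_forall fun n => measureReal_nonneg) ?_ hlim
  filter_upwards [eventually_ge_atTop 2, hτ.eventually_const_lt (sub_lt_self b hc)] with n hn hτn
  have hn' : (1 : ℝ) < n := by exact_mod_cast hn
  have hn0 : (0 : ℝ) < n := by linarith
  refine (altLaw_real_maxStat_le_exp G (by lia) hβ0 _).trans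
    (Real.exp_le_exp.2 (neg_le_neg ?_))
  rw [← natCast_rpow_tau_one G hn, ← Real.rpow_add hn0]
  nth_rewrite 2 [← Real.rpow_one (n : ℝ)]
  rw [← Real.rpow_add hn0]
  exact Real.rpow_le_rpow_of_exponent_le hn'.le (by linarith)

theorem tendsto_maxTestPower (hτ : Tendsto (fun n => tau G n 1) atTop (𝓝 b)) (hβ0 : 0 ≤ β)
    (hβ : β < 1 + b) {α : ℝ} (hα0 : 0 < α) (hα1 : α < 1) :
    Tendsto (maxTestPower G β α) atTop (𝓝 1) := by
  have h := (tendsto_altLaw_real_maxStat_le hτ hβ0 hβ).const_sub 1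
  rw [sub_zero] at h
  have := fun n => isProbabilityMeasure_altLaw G n hβ0
  refine tendsto_of_tendsto_of_tendsto_of_le_of_le' h tendsto_const_nhds ?_
    (Eventually.of_forall fun n => measureReal_le_one)
  filter_upwards [eventually_ge_atTop 1,
    tendsto_mul_absTail_gaussianReal.eventually_lt_const hα0] with n hn hnα
  rw [← probReal_compl_eq_one_sub (measurableSet_maxStat_le hn _)]
  exact measureReal_mono fun x hx => (maxCritVal_le hn hα1 hnα.le).trans_lt (not_le.1 hx)

theorem tendsto_tvDist_one (hτ : Tendsto (fun n => tau G n 1) atTop (𝓝 b)) (hβ0 : 0 ≤ β)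
    (hβ : β < 1 + b) : Tendsto (fun n => tvDist (nullLaw n) (altLaw G β n)) atTop (𝓝 1) := by
  have h := tendsto_nullLaw_real_maxStat_le.sub (tendsto_altLaw_real_maxStat_le hτ hβ0 hβ)
  rw [sub_zero] at h
  have := fun n => isProbabilityMeasure_altLaw G n hβ0
  refine tendsto_of_tendsto_of_tendsto_of_le_of_le' h tendsto_const_nhds ?_
    (Eventually.of_forall fun n => tvDist_le_one _ _)
  filter_upwards [eventually_ge_atTop 1] with n hn
  exact real_sub_real_le_tvDist _ _ (measurableSet_maxStat_le hn _)

end MaxTest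

section CriticalLevels

variable {G : ℕ → Measure ℝ} [∀ n, IsProbabilityMeasure (G n)] {b M : ℝ}

lemma lowerCriticalSparsity_le (hM : DetectionExponentLE G M) (hM0 : 0 ≤ 1 / 2 + M) :
    lowerCriticalSparsity G ≤ 1 / 2 + M := by
  refine csSup_le (Set.insert_nonempty _ _) ?_
  rintro β (rfl | ⟨hβ0, hβ⟩)
  · exact hM0
  · by_contra! h
    exact zero_ne_one (tendsto_nhds_unique (tendsto_tvDist_zero hM hβ0 h) hβ)

lemma upperCriticalSparsity_le (hM : DetectionExponentLE G M) (hM0 : 0 ≤ 1 / 2 + M) :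
    upperCriticalSparsity G ≤ 1 / 2 + M := by
  have hbdd : BddBelow (insert (1 : ℝ) {β : ℝ | 0 ≤ β ∧ β ≤ 1 ∧
      Tendsto (fun n => tvDist (nullLaw n) (altLaw G β n)) atTop (𝓝 0)}) :=
    ⟨0, by rintro β (rfl | hβ); exacts [zero_le_one, hβ.1]⟩
  refine le_of_forall_gt_imp_ge_of_dense fun β hβ => ?_
  rcases le_total β 1 with hβ1 | hβ1
  · have hβ0 : 0 ≤ β := by linarith
    exact csInf_le hbdd (Or.inr ⟨hβ0, hβ1, tendsto_tvDist_zero hM hβ0 hβ⟩)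
  · exact (csInf_le hbdd (Or.inl rfl)).trans hβ1

lemma one_add_le_lowerCriticalSparsity (hM : DetectionExponentLE G M)
    (hτ : Tendsto (fun n => tau G n 1) atTop (𝓝 b)) :
    1 + b ≤ lowerCriticalSparsity G := by
  have hbdd : BddAbove (insert (0 : ℝ) {β : ℝ | 0 ≤ β ∧
      Tendsto (fun n => tvDist (nullLaw n) (altLaw G β n)) atTop (𝓝 1)}) := by
    refine BddAbove.insert _ ⟨1 / 2 + M, fun β ⟨hβ0, hβ⟩ => ?_⟩
    by_contra! h
    exact zero_ne_one (tendsto_nhds_unique (tendsto_tvDist_zero hM hβ0 h) hβ)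
  refine le_of_forall_lt_imp_le_of_dense fun β hβ => ?_
  rcases le_total β 0 with hβ0 | hβ0
  · exact hβ0.trans (le_csSup hbdd (Or.inl rfl))
  · exact le_csSup hbdd (Or.inr ⟨hβ0, tendsto_tvDist_one hτ hβ0 hβ⟩)

lemma one_add_le_upperCriticalSparsity (hτ : Tendsto (fun n => tau G n 1) atTop (𝓝 b)) :
    1 + b ≤ upperCriticalSparsity G := by
  have hb : b ≤ 0 := le_of_tendsto' hτ fun n => tau_nonpos G n 1
  refine le_csInf ⟨1, Or.inl rfl⟩ ?_
  rintro β (rfl | ⟨hβ0, _, hβ⟩)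
  · linarith
  · by_contra! h
    exact zero_ne_one (tendsto_nhds_unique hβ (tendsto_tvDist_one hτ hβ0 h))

lemma isCriticalSparsityLevel_one_add (hτ : Tendsto (fun n => tau G n 1) atTop (𝓝 b))
    (hM : DetectionExponentLE G (b + 1 / 2)) (hb : 0 ≤ 1 + b) :
    IsCriticalSparsityLevel G (1 + b) := by
  have hb' : 1 / 2 + (b + 1 / 2) = 1 + b := by ring
  have hM0 : 0 ≤ 1 / 2 + (b + 1 / 2) := hb'.symm ▸ hb
  exact ⟨le_antisymm ((lowerCriticalSparsity_le hM hM0).trans_eq hb')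
      (one_add_le_lowerCriticalSparsity hM hτ),
    le_antisymm ((upperCriticalSparsity_le hM hM0).trans_eq hb')
      (one_add_le_upperCriticalSparsity hτ)⟩

-- If no exponent `τ(δ) + δ / 2` exceeded `c`, the upper level would be at most `1 / 2 + c`.
theorem isCriticalSparsityLevel_of_dominated {τ : ℝ → ℝ} {c : ℝ}
    (hτ : ∀ δ ∈ Set.Icc (0 : ℝ) 1, Tendsto (fun n => tau G n δ) atTop (𝓝 (τ δ))) (hc : 0 ≤ c)
    (hdom : ∀ δ ∈ Set.Icc (0 : ℝ) 1, c < τ δ + δ / 2 → τ δ + δ / 2 ≤ τ 1 + 1 / 2)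
    (hupper : 1 / 2 + c < upperCriticalSparsity G) :
    IsCriticalSparsityLevel G (1 + τ 1) := by
  obtain ⟨δ, hδ, hcδ⟩ : ∃ δ ∈ Set.Icc (0 : ℝ) 1, c < τ δ + δ / 2 := by
    by_contra! h
    exact hupper.not_ge
      (upperCriticalSparsity_le (detectionExponentLE_of_tendsto hτ h) (by linarith))
  have hcτ : c < τ 1 + 1 / 2 := hcδ.trans_le (hdom δ hδ hcδ)
  refine isCriticalSparsityLevel_one_add (hτ 1 ⟨zero_le_one, le_rfl⟩)
    (detectionExponentLE_of_tendsto hτ fun δ hδ => ?_) (by linarith)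
  exact (le_or_gt (τ δ + δ / 2) c).elim (fun h => h.trans hcτ.le) (hdom δ hδ)

end CriticalLevels

section TailMax

/-- The larger of the two tails `P(X > θ)` and `P(X ≤ -θ)` of the law of `X`; its negative
logarithm is `tailExponent`. -/
def tailMax (ν : Measure ℝ) (θ : ℝ) : ℝ :=
  max (1 - cdf ν θ) (cdf ν (-θ))

variable (ν : Measure ℝ)

lemma tailMax_nonneg (θ : ℝ) : 0 ≤ tailMax ν θ :=
  (cdf_nonneg ν _).trans (le_max_right _ _)

lemma tailMax_le_one (θ : ℝ) : tailMax ν θ ≤ 1 :=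
  max_le (sub_le_self 1 (cdf_nonneg ν θ)) (cdf_le_one ν _)

lemma antitone_tailMax : Antitone (tailMax ν) := fun _ _ h =>
  max_le_max (sub_le_sub_left (monotone_cdf ν h) 1) (monotone_cdf ν (neg_le_neg h))

lemma one_half_le_tailMax_zero : 1 / 2 ≤ tailMax ν 0 := by
  rw [tailMax, neg_zero]
  rcases le_total (cdf ν 0) (1 / 2) with h | h
  · exact le_max_of_le_left (by linarith)
  · exact le_max_of_le_right h

variable [IsProbabilityMeasure ν]

lemma one_sub_cdf (θ : ℝ) : 1 - cdf ν θ = ν.real (Set.Ioi θ) := by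
  rw [cdf_eq_real, ← probReal_compl_eq_one_sub measurableSet_Iic, Set.compl_Iic]

lemma absTail_le_two_mul_tailMax (θ : ℝ) : absTail ν θ ≤ 2 * tailMax ν θ := by
  have hright : ν.real (Set.Ioi θ) ≤ tailMax ν θ := one_sub_cdf ν θ ▸ le_max_left _ _
  have hleft : ν.real (Set.Iio (-θ)) ≤ tailMax ν θ :=
    (measureReal_mono Set.Iio_subset_Iic_self).trans (cdf_eq_real ν (-θ) ▸ le_max_right _ _)
  rw [absTail, setOf_lt_abs_eq_union]
  exact (measureReal_union_le _ _).trans (by linarith)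

lemma measureReal_mul_gaussianTail_le {θ : ℝ} {s : Set ℝ} (hs : MeasurableSet s)
    (hsθ : ∀ m ∈ s, θ ≤ |m|) (t : ℝ) :
    ν.real s * gaussianTail (t - θ) ≤ absTail (gaussianMixture ν) t := by
  have hint := integrable_absTail_gaussianReal ν t
  rw [absTail_gaussianMixture]
  calc ν.real s * gaussianTail (t - θ) = ∫ _m in s, gaussianTail (t - θ) ∂ν := by simp
    _ ≤ ∫ m in s, absTail (gaussianReal m 1) t ∂ν :=
        setIntegral_mono_on (by simp) hint.integrableOn hs fun m hm =>
          (antitone_gaussianTail (by linarith [hsθ m hm])).trans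
            (gaussianTail_le_absTail_gaussianReal m t)
    _ ≤ ∫ m, absTail (gaussianReal m 1) t ∂ν :=
        setIntegral_le_integral hint (ae_of_all _ fun m => absTail_nonneg _ t)

lemma tailMax_mul_gaussianTail_le (θ t : ℝ) :
    tailMax ν θ * gaussianTail (t - θ) ≤ absTail (gaussianMixture ν) t := by
  rcases max_choice (1 - cdf ν θ) (cdf ν (-θ)) with h | h
  · rw [tailMax, h, one_sub_cdf]
    exact measureReal_mul_gaussianTail_le ν measurableSet_Ioi
      (fun m hm => (le_of_lt hm).trans (le_abs_self m)) t
  · rw [tailMax, h, cdf_eq_real]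
    exact measureReal_mul_gaussianTail_le ν measurableSet_Iic
      (fun m hm => (le_neg.2 hm).trans (neg_le_abs m)) t

end TailMax

section Shells

lemma exists_shell (θ : ℕ → ℝ) (a : ℝ) (K : ℕ) :
    ∃ j ≤ K, (j = 0 ∨ θ j < a) ∧ (j = K ∨ a ≤ θ (j + 1)) := by
  classical
  set P : ℕ → Prop := fun j => j = 0 ∨ θ j < a
  have hle : Nat.findGreatest P K ≤ K := Nat.findGreatest_le K
  have hspec : P (Nat.findGreatest P K) := Nat.findGreatest_spec (Nat.zero_le K) (Or.inl rfl)
  refine ⟨Nat.findGreatest P K, hle, hspec, ?_⟩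
  rcases hle.eq_or_lt with h | h
  · exact Or.inl h
  · refine Or.inr (le_of_not_gt fun hlt => ?_)
    exact Nat.findGreatest_is_greatest (P := P) (Nat.lt_succ_self _) h (Or.inr hlt)

lemma absTail_gaussianReal_le_exp {m t θ : ℝ} (h : t ≤ θ ∨ |m| ≤ θ) :
    absTail (gaussianReal m 1) t ≤ 2 * Real.exp (-max (t - θ) 0 ^ 2 / 2) := by
  rcases h with h | h
  · rw [max_eq_right (by linarith)]
    exact (absTail_le_one _ _).trans (by norm_num)
  · refine (absTail_gaussianReal_le m t).trans ?_
    gcongr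
    exact (antitone_gaussianTail (by linarith)).trans (gaussianTail_le_exp_neg_max_sq _)

variable (ν : Measure ℝ) [IsProbabilityMeasure ν] {t : ℝ} {K : ℕ} {θ : ℕ → ℝ}

lemma absTail_gaussianMixture_le_sum (hθ0 : θ 0 = 0) (hθK : t ≤ θ (K + 1)) :
    absTail (gaussianMixture ν) t ≤ ∑ j ∈ Finset.range (K + 1),
      2 * Real.exp (-max (t - θ (j + 1)) 0 ^ 2 / 2) * (2 * tailMax ν (θ j)) := by
  set shell : ℕ → Set ℝ := fun j => {m | j = 0 ∨ θ j < |m|}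
  set w : ℕ → ℝ := fun j => 2 * Real.exp (-max (t - θ (j + 1)) 0 ^ 2 / 2)
  have hshell : ∀ j, MeasurableSet (shell j) := fun j =>
    (MeasurableSet.const _).union (measurableSet_lt_abs _)
  have hmass : ∀ j, ν.real (shell j) ≤ 2 * tailMax ν (θ j) := by
    intro j
    rcases eq_or_ne j 0 with rfl | hj
    · rw [hθ0]
      exact measureReal_le_one.trans (by linarith [one_half_le_tailMax_zero ν])
    · simpa only [shell, hj, false_or, absTail] using absTail_le_two_mul_tailMax ν (θ j)
  have hpointwise : ∀ m, absTail (gaussianReal m 1) t ≤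
      ∑ j ∈ Finset.range (K + 1), (shell j).indicator (fun _ => w j) m := by
    intro m
    obtain ⟨j, hjK, hmj, hle⟩ := exists_shell θ |m| K
    calc absTail (gaussianReal m 1) t ≤ w j :=
          absTail_gaussianReal_le_exp (hle.imp_left fun h : j = K => by rwa [h])
      _ = (shell j).indicator (fun _ => w j) m := (Set.indicator_of_mem hmj fun _ => w j).symm
      _ ≤ _ := Finset.single_le_sum (f := fun j => (shell j).indicator (fun _ => w j) m)
          (fun i _ => Set.indicator_nonneg (fun _ _ => by positivity) m)
          (Finset.mem_range_succ_iff.2 hjK)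
  have hint : ∀ j ∈ Finset.range (K + 1), Integrable ((shell j).indicator fun _ => w j) ν :=
    fun j _ => (integrable_const (w j)).indicator (hshell j)
  calc absTail (gaussianMixture ν) t
      ≤ ∫ m, ∑ j ∈ Finset.range (K + 1), (shell j).indicator (fun _ => w j) m ∂ν := by
        rw [absTail_gaussianMixture]
        exact integral_mono (integrable_absTail_gaussianReal ν t) (integrable_finsetSum _ hint)
          hpointwise
    _ = ∑ j ∈ Finset.range (K + 1), w j * ν.real (shell j) := by
        rw [integral_finsetSum _ hint]
        refine Finset.sum_congr rfl fun j _ => ?_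
        rw [integral_indicator (hshell j), setIntegral_const, smul_eq_mul, mul_comm]
    _ ≤ _ := Finset.sum_le_sum fun j _ => by gcongr; exact hmass j

lemma exists_absTail_gaussianMixture_le (hθ0 : θ 0 = 0) (hθK : t ≤ θ (K + 1)) :
    ∃ j ≤ K, absTail (gaussianMixture ν) t ≤
      4 * (K + 1) * (Real.exp (-max (t - θ (j + 1)) 0 ^ 2 / 2) * tailMax ν (θ j)) := by
  obtain ⟨j, hj, hle⟩ := Finset.exists_le_of_sum_le (s := Finset.range (K + 1))
    (f := fun _ => absTail (gaussianMixture ν) t / (K + 1)) (by simp)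
    (le_of_eq_of_le (by simp; field_simp) (absTail_gaussianMixture_le_sum ν hθ0 hθK))
  refine ⟨j, Finset.mem_range_succ_iff.1 hj, ?_⟩
  rw [div_le_iff₀ (by positivity)] at hle
  exact hle.trans_eq (by ring)

end Shells

section DominantShell

variable (G : ℕ → Measure ℝ) [∀ n, IsProbabilityMeasure (G n)] {ε : ℝ}

lemma sq_mul_one_sub_sq_sub_le {d u h : ℝ} (hd : d ∈ Set.Icc (0 : ℝ) 1)
    (hu : u ∈ Set.Icc (0 : ℝ) 1) (hh : 0 ≤ h) :
    d ^ 2 * (1 - u) ^ 2 - 2 * h ≤ (d * max (1 - u - h) 0) ^ 2 := by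
  obtain ⟨hd0, hd1⟩ := hd
  obtain ⟨hu0, hu1⟩ := hu
  have hd2 : d ^ 2 ≤ 1 := pow_le_one₀ hd0 hd1
  have hsq : (1 - u) ^ 2 - 2 * h ≤ max (1 - u - h) 0 ^ 2 := by
    rcases le_total (1 - u - h) 0 with hle | hle
    · rw [max_eq_right hle]; nlinarith
    · rw [max_eq_left hle]; nlinarith
  rw [mul_pow]
  nlinarith [sq_nonneg d]

lemma exists_natCast_rpow_tau_le {d : ℝ} (hd : d ∈ Set.Icc (0 : ℝ) 1) (hε : 0 < ε) :
    ∃ K : ℕ, 1 ≤ K ∧ ∀ᶠ n : ℕ in atTop, ∃ j ≤ K, (n : ℝ) ^ tau G n (d ^ 2) ≤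
      (n : ℝ) ^ (ε - d ^ 2 * (1 - j / K) ^ 2) *
        tailMax (G n) (j / K * (d * universalThreshold n)) := by
  obtain ⟨K, hK⟩ := exists_nat_gt (4 / ε)
  have hK0 : (0 : ℝ) < K := (by positivity : 0 < 4 / ε).trans hK
  have hKε : 2 * (1 / K : ℝ) ≤ ε / 2 := by
    rw [div_lt_iff₀ hε] at hK
    rw [mul_one_div, div_le_iff₀ hK0]
    linarith
  refine ⟨K, by exact_mod_cast hK0, ?_⟩
  have hgrow : Tendsto (fun n : ℕ => (n : ℝ) ^ (ε / 2)) atTop atTop :=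
    (tendsto_rpow_atTop (half_pos hε)).comp tendsto_natCast_atTop_atTop
  filter_upwards [eventually_ge_atTop 2, hgrow.eventually_ge_atTop (4 * (K + 1))] with n hn hbig
  have hn' : (1 : ℝ) < n := by exact_mod_cast hn
  have hr := universalThreshold_nonneg n
  set t := d * universalThreshold n
  have ht : 0 ≤ t := mul_nonneg hd.1 hr
  obtain ⟨j, hj, hle⟩ := exists_absTail_gaussianMixture_le (G n) (t := t) (K := K)
    (θ := fun j => j / K * t) (by simp) (le_mul_of_one_le_left ht (by
      rw [one_le_div hK0]; push_cast; linarith))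
  refine ⟨j, hj, ?_⟩
  set u : ℝ := j / K with hu
  have hu01 : u ∈ Set.Icc (0 : ℝ) 1 :=
    ⟨by positivity, div_le_one_of_le₀ (by exact_mod_cast hj) hK0.le⟩
  have hgap : max (t - (j + 1 : ℕ) / K * t) 0 =
      d * max (1 - u - 1 / K) 0 * universalThreshold n := by
    rw [mul_right_comm, mul_comm (d * _), max_mul_of_nonneg _ _ ht, zero_mul, hu]
    push_cast
    ring_nf
  have hexp : Real.exp (-max (t - (j + 1 : ℕ) / K * t) 0 ^ 2 / 2) ≤
      (n : ℝ) ^ (ε / 2 - d ^ 2 * (1 - u) ^ 2) := by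
    rw [hgap, ← neg_one_mul, exp_mul_universalThreshold_sq (by lia)]
    refine Real.rpow_le_rpow_of_exponent_le hn'.le ?_
    linarith [sq_mul_one_sub_sq_sub_le hd hu01 (by positivity : (0 : ℝ) ≤ 1 / K)]
  have hT := tailMax_nonneg (G n) (u * t)
  calc (n : ℝ) ^ tau G n (d ^ 2) = absTail (gaussianMixture (G n)) t := natCast_rpow_tau G hn hd.1
    _ ≤ (n : ℝ) ^ (ε / 2) * ((n : ℝ) ^ (ε / 2 - d ^ 2 * (1 - u) ^ 2) *
        tailMax (G n) (u * t)) := hle.trans (by gcongr)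
    _ = _ := by
        rw [← mul_assoc, ← Real.rpow_add (by linarith)]
        congr 2; ring

lemma eventually_tailMax_le_rpow (hε : 0 < ε) :
    ∀ᶠ n : ℕ in atTop, ∀ v ∈ Set.Icc (0 : ℝ) 1,
      tailMax (G n) (v * universalThreshold n) ≤ (n : ℝ) ^ (tau G n 1 + (1 - v) ^ 2 + ε) := by
  have hpoly := ((tendsto_one_add_universalThreshold_mul_rpow_neg hε).const_mul
    gaussianTailConst).eventually_le_const (by rw [mul_zero]; exact one_pos)
  filter_upwards [eventually_ge_atTop 2, hpoly] with n hn hpoly v hv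
  have hn0 : (0 : ℝ) < n := by positivity
  have := gaussianTailConst_pos
  set r := universalThreshold n
  have hr : 0 ≤ r := universalThreshold_nonneg n
  have hconst : gaussianTailConst * (1 + r) ≤ (n : ℝ) ^ ε := by
    rwa [Real.rpow_neg hn0.le, ← mul_assoc, ← div_eq_mul_inv, div_le_one (by positivity)] at hpoly
  have hexp : (n : ℝ) ^ (1 - v) ^ 2 * Real.exp (-(r - v * r) ^ 2 / 2) = 1 := by
    rw [← one_sub_mul, ← neg_one_mul (_ ^ 2), exp_mul_universalThreshold_sq (by lia),
      ← Real.rpow_add hn0, neg_one_mul, add_neg_cancel, Real.rpow_zero]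
  have hshift : 1 ≤ (n : ℝ) ^ (1 - v) ^ 2 * ((n : ℝ) ^ ε * gaussianTail (r - v * r)) := by
    refine hexp.ge.trans ?_
    gcongr
    exact (exp_neg_sq_div_two_le_mul_gaussianTail hr (sub_le_self r (mul_nonneg hv.1 hr))).trans
      (mul_le_mul_of_nonneg_right hconst (gaussianTail_nonneg _))
  calc tailMax (G n) (v * r)
      ≤ tailMax (G n) (v * r) * ((n : ℝ) ^ (1 - v) ^ 2 *
        ((n : ℝ) ^ ε * gaussianTail (r - v * r))) :=
        le_mul_of_one_le_right (tailMax_nonneg _ _) hshift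
    _ = tailMax (G n) (v * r) * gaussianTail (r - v * r) *
        ((n : ℝ) ^ (1 - v) ^ 2 * (n : ℝ) ^ ε) := by ring
    _ ≤ (n : ℝ) ^ tau G n 1 * ((n : ℝ) ^ (1 - v) ^ 2 * (n : ℝ) ^ ε) := by
        rw [natCast_rpow_tau_one G hn]
        gcongr
        exact tailMax_mul_gaussianTail_le (G n) _ _
    _ = (n : ℝ) ^ (tau G n 1 + (1 - v) ^ 2 + ε) := by
        rw [Real.rpow_add hn0, Real.rpow_add hn0, mul_assoc]

end DominantShell

section QuarterCase

variable (G : ℕ → Measure ℝ) [∀ n, IsProbabilityMeasure (G n)]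

lemma eventually_tau_add_half_le {d ε : ℝ} (hd : d ∈ Set.Icc (0 : ℝ) 1) (hε : 0 < ε) :
    ∀ᶠ n in atTop, 1 / 4 + ε < tau G n (d ^ 2) + d ^ 2 / 2 →
      tau G n (d ^ 2) + d ^ 2 / 2 ≤ tau G n 1 + 1 / 2 + 2 * ε := by
  obtain ⟨K, hK, hdominant⟩ := exists_natCast_rpow_tau_le G hd hε
  have hK0 : (0 : ℝ) < K := by exact_mod_cast hK
  filter_upwards [hdominant, eventually_tailMax_le_rpow G hε, eventually_ge_atTop 2]
    with n ⟨j, hj, hle⟩ htail hn hquarter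
  have hn1 : (1 : ℝ) < n := by exact_mod_cast hn
  have hn0 : (0 : ℝ) < n := one_pos.trans hn1
  obtain ⟨hd0, hd1⟩ := hd
  set u : ℝ := j / K
  have hu0 : 0 ≤ u := by positivity
  have hu1 : u ≤ 1 := div_le_one_of_le₀ (by exact_mod_cast hj) hK0.le
  have hcrude : tau G n (d ^ 2) ≤ ε - d ^ 2 * (1 - u) ^ 2 :=
    (Real.rpow_le_rpow_left_iff hn1).1 <|
      hle.trans (mul_le_of_le_one_right (by positivity) (tailMax_le_one _ _))
  have hud : 1 / 2 < u * d := by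
    by_contra! h
    nlinarith [sq_nonneg (d - 2 * (u * d))]
  have hsharp : tau G n (d ^ 2) ≤ ε - d ^ 2 * (1 - u) ^ 2 + (tau G n 1 + (1 - u * d) ^ 2 + ε) := by
    rw [← mul_assoc] at hle
    rw [← Real.rpow_le_rpow_left_iff hn1, Real.rpow_add hn0]
    exact hle.trans (mul_le_mul_of_nonneg_left
      (htail (u * d) ⟨by positivity, mul_le_one₀ hu1 hd0 hd1⟩) (by positivity))
  have hgain : d ^ 2 / 2 - 1 / 2 ≤ d ^ 2 * (1 - u) ^ 2 - (1 - u * d) ^ 2 := by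
    nlinarith [mul_nonneg (sub_nonneg.2 hd1) (by linarith : 0 ≤ 2 * (u * d) - 1),
      mul_nonneg (sub_nonneg.2 hd1) (sub_nonneg.2 hd1)]
  linarith

lemma tau_add_half_le_of_quarter_lt {δ a b : ℝ} (hδ : δ ∈ Set.Icc (0 : ℝ) 1)
    (ha : Tendsto (fun n => tau G n δ) atTop (𝓝 a)) (hb : Tendsto (fun n => tau G n 1) atTop (𝓝 b))
    (hquarter : 1 / 4 < a + δ / 2) : a + δ / 2 ≤ b + 1 / 2 := by
  obtain ⟨d, hd, rfl⟩ : ∃ d ∈ Set.Icc (0 : ℝ) 1, d ^ 2 = δ :=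
    ⟨√δ, ⟨Real.sqrt_nonneg _, Real.sqrt_le_one.2 hδ.2⟩, Real.sq_sqrt hδ.1⟩
  have ha' := ha.add_const (d ^ 2 / 2)
  have hlim : Tendsto (fun ε : ℝ => b + 1 / 2 + 2 * ε) (𝓝[>] 0) (𝓝 (b + 1 / 2)) := by
    have hcont : Continuous fun ε : ℝ => b + 1 / 2 + 2 * ε := by fun_prop
    simpa using (hcont.tendsto 0).mono_left nhdsWithin_le_nhds
  refine ge_of_tendsto hlim ?_
  filter_upwards [self_mem_nhdsWithin,
    Ioo_mem_nhdsGT (sub_pos.2 hquarter)] with ε hε hεquarter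
  refine le_of_tendsto_of_tendsto ha' ((hb.add_const (1 / 2)).add_const (2 * ε)) ?_
  filter_upwards [eventually_tau_add_half_le G hd hε,
    ha'.eventually_const_lt (lt_sub_iff_add_lt'.1 hεquarter.2)] with n hn hquarter using hn hquarter

end QuarterCase

section ScaleFamily

variable {G : ℕ → Measure ℝ} {ν : Measure ℝ} {σ : ℕ → ℝ} {γ d ε : ℝ}

lemma log_tailMax (ν : Measure ℝ) (θ : ℝ) : Real.log (tailMax ν θ) = -tailExponent ν θ := by
  rw [tailExponent, neg_neg, tailMax]

lemma tailMax_pos (h : ∀ᶠ θ in atTop, 0 < tailExponent ν θ) (θ : ℝ) : 0 < tailMax ν θ := by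
  obtain ⟨x, hx, hθx⟩ := (h.and (eventually_ge_atTop θ)).exists
  refine ((tailMax_nonneg ν x).lt_of_ne fun h0 => ?_).trans_le (antitone_tailMax ν hθx)
  have hlog := log_tailMax ν x
  rw [← h0, Real.log_zero] at hlog
  linarith

lemma tailMax_eq_of_cdf_eq {ν' : Measure ℝ} {s : ℝ} (h : ∀ θ, cdf ν' θ = cdf ν (θ / s)) (θ : ℝ) :
    tailMax ν' θ = tailMax ν (θ / s) := by
  rw [tailMax, tailMax, h, h, neg_div]

lemma eventually_tailMax_rpow_le (hreg : RegularlyVarying (tailExponent ν) γ) (hγ : γ ≤ 2)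
    (hd0 : 0 < d) (hd1 : d ≤ 1) (hε : 0 < ε) :
    ∀ᶠ x in atTop, tailMax ν x ^ (1 + ε) ≤ tailMax ν (d⁻¹ * x) ^ (d ^ 2) := by
  have hindex : d⁻¹ ^ γ < (1 + ε) / d ^ 2 := by
    calc d⁻¹ ^ γ ≤ d⁻¹ ^ (2 : ℝ) :=
          Real.rpow_le_rpow_of_exponent_le ((one_le_inv₀ hd0).2 hd1) hγ
      _ = 1 / d ^ 2 := by rw [Real.rpow_two, inv_pow, one_div]
      _ < (1 + ε) / d ^ 2 := by gcongr; linarith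
  filter_upwards [hreg.1, (hreg.2 d⁻¹ (inv_pos.2 hd0)).eventually_lt_const hindex] with x hx hlt
  rw [div_lt_div_iff₀ hx (by positivity)] at hlt
  rw [Real.rpow_def_of_pos (tailMax_pos hreg.1 _), Real.rpow_def_of_pos (tailMax_pos hreg.1 _),
    Real.exp_le_exp, log_tailMax, log_tailMax]
  linarith

lemma eventually_tailMax_rpow_le_of_scale (hscale : ∀ n θ, cdf (G n) θ = cdf ν (θ / σ n))
    (hreg : RegularlyVarying (tailExponent ν) γ) (hγ : γ ≤ 2)
    (hσ : Tendsto (fun n => universalThreshold n / σ n) atTop atTop)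
    (hd0 : 0 < d) (hd1 : d ≤ 1) (hε : 0 < ε) {v : ℝ} (hv : 0 ≤ v) :
    ∀ᶠ n in atTop, tailMax (G n) (v * (d * universalThreshold n)) ^ (1 + ε) ≤
      tailMax (G n) (v * universalThreshold n) ^ (d ^ 2) := by
  simp only [fun n => tailMax_eq_of_cdf_eq (hscale n)]
  rcases hv.eq_or_lt with rfl | hv
  · simp only [zero_mul, zero_div]
    exact .of_forall fun _ => Real.rpow_le_rpow_of_exponent_ge (tailMax_pos hreg.1 0)
      (tailMax_le_one ν 0) (by nlinarith)
  · have htend : Tendsto (fun n => v * (d * universalThreshold n) / σ n) atTop atTop :=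
      (hσ.const_mul_atTop (mul_pos hv hd0)).congr fun n => by ring
    filter_upwards [htend.eventually (eventually_tailMax_rpow_le hreg hγ hd0 hd1 hε)] with n hn
    convert hn using 3
    field_simp

variable [∀ n, IsProbabilityMeasure (G n)]

lemma eventually_mul_tau_le (hscale : ∀ n θ, cdf (G n) θ = cdf ν (θ / σ n))
    (hreg : RegularlyVarying (tailExponent ν) γ) (hγ : γ ≤ 2)
    (hσ : Tendsto (fun n => universalThreshold n / σ n) atTop atTop)
    (hd0 : 0 < d) (hd1 : d ≤ 1) (hε : 0 < ε) :
    ∀ᶠ n in atTop, (1 + ε) * tau G n (d ^ 2) ≤ d ^ 2 * tau G n 1 + ε * (2 + ε) := by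
  obtain ⟨K, hK, hdominant⟩ := exists_natCast_rpow_tau_le G ⟨hd0.le, hd1⟩ hε
  have hK0 : (0 : ℝ) < K := by exact_mod_cast hK
  have hgrid := (Finset.range (K + 1)).eventually_all.2 fun j _ =>
    eventually_tailMax_rpow_le_of_scale hscale hreg hγ hσ hd0 hd1 hε
      (by positivity : (0 : ℝ) ≤ j / K)
  filter_upwards [hdominant, hgrid, eventually_tailMax_le_rpow G hε, eventually_ge_atTop 2]
    with n ⟨j, hj, hle⟩ hgrid htail hn
  have hn1 : (1 : ℝ) < n := by exact_mod_cast hn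
  have hn0 : (0 : ℝ) < n := one_pos.trans hn1
  replace hgrid := hgrid j (Finset.mem_range_succ_iff.2 hj)
  set r := universalThreshold n
  set u : ℝ := j / K
  have hu : u ∈ Set.Icc (0 : ℝ) 1 :=
    ⟨by positivity, div_le_one_of_le₀ (by exact_mod_cast hj) hK0.le⟩
  have hT := tailMax_nonneg (G n) (u * (d * r))
  have hexp : (1 + ε) * tau G n (d ^ 2) ≤
      (1 + ε) * (ε - d ^ 2 * (1 - u) ^ 2) + d ^ 2 * (tau G n 1 + (1 - u) ^ 2 + ε) := by
    rw [← Real.rpow_le_rpow_left_iff hn1]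
    calc (n : ℝ) ^ ((1 + ε) * tau G n (d ^ 2)) = ((n : ℝ) ^ tau G n (d ^ 2)) ^ (1 + ε) := by
          rw [← Real.rpow_mul hn0.le, mul_comm]
      _ ≤ ((n : ℝ) ^ (ε - d ^ 2 * (1 - u) ^ 2) * tailMax (G n) (u * (d * r))) ^ (1 + ε) := by
          gcongr
      _ = (n : ℝ) ^ ((1 + ε) * (ε - d ^ 2 * (1 - u) ^ 2)) *
          tailMax (G n) (u * (d * r)) ^ (1 + ε) := by
          rw [Real.mul_rpow (by positivity) hT, ← Real.rpow_mul hn0.le, mul_comm (1 + ε)]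
      _ ≤ (n : ℝ) ^ ((1 + ε) * (ε - d ^ 2 * (1 - u) ^ 2)) *
          ((n : ℝ) ^ (tau G n 1 + (1 - u) ^ 2 + ε)) ^ (d ^ 2) := by
          gcongr
          exact hgrid.trans (by gcongr; exacts [tailMax_nonneg _ _, htail u hu])
      _ = _ := by rw [← Real.rpow_mul hn0.le, ← Real.rpow_add hn0, mul_comm (d ^ 2) (_ + _)]
  have hd2 : d ^ 2 ≤ 1 := pow_le_one₀ hd0.le hd1
  have hsq : 0 ≤ ε * (d ^ 2 * (1 - u) ^ 2) := by positivity
  nlinarith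

lemma le_sq_mul_of_tendsto_tau (hscale : ∀ n θ, cdf (G n) θ = cdf ν (θ / σ n))
    (hreg : RegularlyVarying (tailExponent ν) γ) (hγ : γ ≤ 2)
    (hσ : Tendsto (fun n => universalThreshold n / σ n) atTop atTop)
    (hd0 : 0 < d) (hd1 : d ≤ 1) {a b : ℝ}
    (ha : Tendsto (fun n => tau G n (d ^ 2)) atTop (𝓝 a))
    (hb : Tendsto (fun n => tau G n 1) atTop (𝓝 b)) : a ≤ d ^ 2 * b := by
  have hlim : ∀ {f : ℝ → ℝ}, Continuous f → Tendsto f (𝓝[>] 0) (𝓝 (f 0)) := fun hf =>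
    (hf.tendsto 0).mono_left nhdsWithin_le_nhds
  have hle := le_of_tendsto_of_tendsto
    (hlim (f := fun ε => (1 + ε) * a) (by fun_prop))
    (hlim (f := fun ε => d ^ 2 * b + ε * (2 + ε)) (by fun_prop))
    (eventually_mem_nhdsWithin.mono fun ε hε =>
      le_of_tendsto_of_tendsto (ha.const_mul (1 + ε)) ((hb.const_mul (d ^ 2)).add_const _)
        (eventually_mul_tau_le hscale hreg hγ hσ hd0 hd1 hε))
  simpa using hle

lemma nonneg_of_tendsto_tau_one (hscale : ∀ n θ, cdf (G n) θ = cdf ν (θ / σ n))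
    (hpos : ∀ᶠ θ in atTop, 0 < tailExponent ν θ)
    (hσ : ¬Tendsto (fun n => universalThreshold n / σ n) atTop atTop) {b : ℝ}
    (hb : Tendsto (fun n => tau G n 1) atTop (𝓝 b)) : 0 ≤ b := by
  obtain ⟨C, hC⟩ : ∃ C, ∃ᶠ n in atTop, universalThreshold n / σ n < C := by
    simpa only [tendsto_atTop, not_forall, not_eventually, not_le] using hσ
  by_contra! hb0
  have hsmall : ∀ᶠ n : ℕ in atTop, (n : ℝ) ^ (b / 4) < tailMax ν C := by
    have := (tendsto_natCast_rpow_neg (by linarith : 0 < -(b / 4))).eventually_lt_const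
      (tailMax_pos hpos C)
    simpa only [neg_neg] using this
  obtain ⟨n, hnC, hn, htail, hnb, hsmall⟩ := (hC.and_eventually ((eventually_ge_atTop 2).and
    ((eventually_tailMax_le_rpow G (by linarith : 0 < -(b / 4))).and
      ((hb.eventually_lt_const (by linarith : b < b / 2)).and hsmall)))).exists
  have hn1 : (1 : ℝ) ≤ n := by exact_mod_cast (by lia : 1 ≤ n)
  refine hsmall.not_ge ?_
  calc tailMax ν C ≤ tailMax (G n) (1 * universalThreshold n) := by
        rw [one_mul, tailMax_eq_of_cdf_eq (hscale n)]
        exact antitone_tailMax ν hnC.le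
    _ ≤ (n : ℝ) ^ (tau G n 1 + (1 - 1) ^ 2 + -(b / 4)) := htail 1 (by simp)
    _ ≤ (n : ℝ) ^ (b / 4) := Real.rpow_le_rpow_of_exponent_le hn1 (by linarith)

lemma tau_add_half_le_of_scale (hscale : ∀ n θ, cdf (G n) θ = cdf ν (θ / σ n))
    (hreg : RegularlyVarying (tailExponent ν) γ) (hγ : γ ≤ 2)
    {δ a b : ℝ} (hδ : δ ∈ Set.Icc (0 : ℝ) 1) (ha : Tendsto (fun n => tau G n δ) atTop (𝓝 a))
    (hb : Tendsto (fun n => tau G n 1) atTop (𝓝 b)) (hpos : 0 < a + δ / 2) :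
    a + δ / 2 ≤ b + 1 / 2 := by
  have ha0 : a ≤ 0 := le_of_tendsto' ha fun n => tau_nonpos G n δ
  obtain ⟨hδ0, hδ1⟩ := hδ
  by_cases hσ : Tendsto (fun n => universalThreshold n / σ n) atTop atTop
  · obtain ⟨d, hd0, hd1, rfl⟩ : ∃ d : ℝ, 0 < d ∧ d ≤ 1 ∧ d ^ 2 = δ :=
      ⟨√δ, Real.sqrt_pos.2 (by linarith), Real.sqrt_le_one.2 hδ1, Real.sq_sqrt hδ0⟩
    have hab := le_sq_mul_of_tendsto_tau hscale hreg hγ hσ hd0 hd1 ha hb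
    have hb0 : 0 < b + 1 / 2 := pos_of_mul_pos_right (by linarith : 0 < d ^ 2 * (b + 1 / 2)) hδ0
    calc a + d ^ 2 / 2 ≤ d ^ 2 * (b + 1 / 2) := by linarith
      _ ≤ b + 1 / 2 := mul_le_of_le_one_left hb0.le hδ1
  · linarith [nonneg_of_tendsto_tau_one hscale hreg.1 hσ hb]

end ScaleFamily

end SparseMeans

end

theorem theorem1_general (G : ℕ → Measure ℝ) (hprob : ∀ n, IsProbabilityMeasure (G n))
    (hconv : ∃ τ : ℝ → ℝ, ∀ δ ∈ Set.Icc (0 : ℝ) 1,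
      Tendsto (fun n => SparseMeans.tau G n δ) atTop (𝓝 (τ δ)))
    (hA : 3 / 4 < SparseMeans.upperCriticalSparsity G ∨
      ∃ (G₀ : Measure ℝ) (σ : ℕ → ℝ) (γ : ℝ), IsProbabilityMeasure G₀ ∧ (∀ n, 0 < σ n) ∧
        (∀ n θ, cdf (G n) θ = cdf G₀ (θ / σ n)) ∧
        SparseMeans.RegularlyVarying (SparseMeans.tailExponent G₀) γ ∧ γ ≤ 2)
    (hhalf : 1 / 2 < SparseMeans.upperCriticalSparsity G) :
    SparseMeans.IsCriticalSparsityLevel G (SparseMeans.upperCriticalSparsity G) ∧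
      ∀ β : ℝ, 0 < β → β < SparseMeans.upperCriticalSparsity G →
        ∀ α : ℝ, 0 < α → α < 1 →
          Tendsto (SparseMeans.maxTestPower G β α) atTop (𝓝 1) := by
  obtain ⟨τ, hτ⟩ := hconv
  have hτ1 := hτ 1 (by simp)
  have hcrit : SparseMeans.IsCriticalSparsityLevel G (1 + τ 1) := by
    rcases hA with hquarter | ⟨G₀, σ, γ, _, _, hscale, hreg, hγ⟩
    · exact SparseMeans.isCriticalSparsityLevel_of_dominated hτ (c := 1 / 4) (by norm_num)
        (fun δ hδ => SparseMeans.tau_add_half_le_of_quarter_lt G hδ (hτ δ hδ) hτ1) (by linarith)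
    · exact SparseMeans.isCriticalSparsityLevel_of_dominated hτ le_rfl
        (fun δ hδ => SparseMeans.tau_add_half_le_of_scale hscale hreg hγ hδ (hτ δ hδ) hτ1)
        (by linarith)
  rw [hcrit.2]
  exact ⟨hcrit, fun β hβ0 hβ α hα0 hα1 =>
    SparseMeans.tendsto_maxTestPower hτ1 hβ0.le hβ hα0 hα1⟩

theorem theorem1 (G : ℕ → Measure ℝ) (hprob : ∀ n, IsProbabilityMeasure (G n))
    (hconv : ∃ τ : ℝ → ℝ,
      TendstoUniformlyOn (SparseMeans.tau G) τ atTop (Set.Icc (0 : ℝ) 1))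
    (hA : 3 / 4 < SparseMeans.upperCriticalSparsity G ∨
      ∃ (G₀ : Measure ℝ) (σ : ℕ → ℝ) (γ : ℝ), IsProbabilityMeasure G₀ ∧ (∀ n, 0 < σ n) ∧
        (∀ n θ, cdf (G n) θ = cdf G₀ (θ / σ n)) ∧
        SparseMeans.RegularlyVarying (SparseMeans.tailExponent G₀) γ ∧ γ ≤ 2)
    (hhalf : 1 / 2 < SparseMeans.upperCriticalSparsity G) :
    SparseMeans.IsCriticalSparsityLevel G (SparseMeans.upperCriticalSparsity G) ∧
      ∀ β : ℝ, 0 < β → β < SparseMeans.upperCriticalSparsity G →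
        ∀ α : ℝ, 0 < α → α < 1 →
          Tendsto (SparseMeans.maxTestPower G β α) atTop (𝓝 1) :=
  theorem1_general G hprob (hconv.imp fun _ hτ _ hδ => hτ.tendsto_at hδ) hA hhalf
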